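/- Let $E/\mathbb{Q}$ be an elliptic curve and let $p>3$ be a prime at which $E$ has good supersingular reduction, i.e. $E$ has good reduction $\tilde E$ at $p$ and $a_p := p+1-\#\tilde E(\mathbb{F}_p)\equiv 0 \pmod p$. Let $K=\mathbb{Q}(E[p+1])$ be the $(p+1)$-division field of $E$, i.e. the subfield of $\overline{\mathbb{Q}}$ generated over $\mathbb{Q}$ by the coordinates of the points of $E(\overline{\mathbb{Q}})$ of order dividing $p+1$, and let $\mathcal{O}_K$ be its ring of integers. Suppose that $[K:\mathbb{Q}]>p^2-p$. Then $K$ is not monogenic over $\mathbb{Q}$, i.e. $\mathcal{O}_K$ has no power integral basis $1,\alpha,\dots,\alpha^{[K:\mathbb{Q}]-1}$ over $\mathbb{Z}$. Moreover, $p$ is an essential discriminant divisor of $K$ over $\mathbb{Q}$: for every $\alpha\in\mathcal{O}_K$ with $K=\mathbb{Q}(\alpha)$, the prime $p$ divides the index $[\mathcal{O}_K:\mathbb{Z}[\alpha]]$. -/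

import Mathlib

noncomputable section

/-- The valuation ring `ℤ_(p)` of the `p`-adic valuation on `ℚ`. -/
abbrev pLocalIntegers (p : ℕ) [Fact p.Prime] : ValuationSubring ℚ :=
  (Rat.padicValuation p).valuationSubring

instance pLocalIntegers_isDVR (p : ℕ) [Fact p.Prime] :
    IsDiscreteValuationRing (pLocalIntegers p) := by
  have : IsCyclic (WithZero (Multiplicative ℤ))ˣ :=
    isCyclic_of_surjective (WithZero.unitsWithZeroEquiv (α := Multiplicative ℤ)).symm
      (MulEquiv.surjective _)
  have : Nontrivial (MonoidWithZeroHom.valueGroup (.ofClass (Rat.padicValuation p))) := by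
    rw [Subgroup.nontrivial_iff_exists_ne_one]
    have hp : (Rat.padicValuation p) (p : ℚ) ≠ 0 := by simp [Rat.padicValuation_self]
    refine ⟨Units.mk0 _ hp, Subgroup.subset_closure ⟨(p : ℚ), rfl⟩, fun h => ?_⟩
    have := congrArg Units.val h
    simp [Rat.padicValuation_self] at this
  infer_instance

/-- The trace of Frobenius `q + 1 - #W(k)` of a Weierstrass curve `W` over a finite field `k` with
`q` elements. -/
def frobeniusTrace {k : Type*} [Field k] (W : WeierstrassCurve k) : ℤ :=
  (Nat.card k : ℤ) + 1 - (Nat.card W.toAffine.Point : ℤ)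

/-- `E` has good supersingular reduction at `p`: a minimal model of `E` at `p` has good reduction,
and the trace of Frobenius `a_p` of the reduction satisfies `a_p ≡ 0 mod p`. -/
def HasGoodSupersingularReduction (E : WeierstrassCurve ℚ) (p : ℕ) [Fact p.Prime] : Prop :=
  (E.minimal (pLocalIntegers p)).HasGoodReduction (pLocalIntegers p) ∧
    (p : ℤ) ∣ frobeniusTrace ((E.minimal (pLocalIntegers p)).reduction (pLocalIntegers p))

open Classical in
/-- The `n`-division field `ℚ(E[n])`: the subfield of the algebraic closure of `ℚ` generated by the
coordinates of all affine points `(x, y)` of `E` over the algebraic closure that are killed by `n`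
in the group law. -/
def divisionField (E : WeierstrassCurve ℚ) (n : ℕ) :
    IntermediateField ℚ (AlgebraicClosure ℚ) :=
  IntermediateField.adjoin ℚ
    {z | ∃ (x y : AlgebraicClosure ℚ)
        (h : (E.baseChange (AlgebraicClosure ℚ)).toAffine.Nonsingular x y),
      n • WeierstrassCurve.Affine.Point.some x y h = 0 ∧ (z = x ∨ z = y)}

/-- A number field `K` is monogenic (over `ℚ`) if its ring of integers has a power integral
basis, that is, a `ℤ`-basis `1, α, …, α ^ (d - 1)`. -/
def IsMonogenicField (K : Type*) [Field K] : Prop :=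
  Nonempty (PowerBasis ℤ (NumberField.RingOfIntegers K))

/-- `p` is an essential discriminant divisor of the number field `K`: it divides the index
`[𝓞 K : ℤ[α]]` for every algebraic integer `α` with `K = ℚ(α)`. -/
def IsEssentialDiscriminantDivisor (p : ℕ) (K : Type*) [Field K] [Algebra ℚ K] : Prop :=
  ∀ α : NumberField.RingOfIntegers K, IntermediateField.adjoin ℚ {(α : K)} = ⊤ →
    p ∣ (Subalgebra.toSubmodule (Algebra.adjoin ℤ {α})).toAddSubgroup.index

end

/-! Suppose that p does not divide the index of ℤ[α]; then [K:ℚ] ≤ p² - p, as follows. Let B be the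
integral closure of ℤ_(p) in K and θ : B → Ω a homomorphism to an algebraic closure of 𝔽_p. By
`ringHom_eq_of_not_dvd_index` a homomorphism B → Ω is determined by its value at α. Torsion of order
prime to p reduces injectively, so an automorphism σ of K is determined by θ ∘ σ; hence σ ↦ θ(σα) is
injective. Frobenius of a supersingular curve satisfies φ² = 1 on the (p + 1)-torsion, so θ takes
values in 𝔽_{p²}. If some θ(σα) lies in 𝔽_p, so does all of θ(B), and there are at most p
automorphisms; otherwise all values lie in 𝔽_{p²} \ 𝔽_p, which has p² - p elements
(`card_algEquiv_le`).

The facts on elliptic curves are proved by elementary means. Multiples of a point are controlled by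
division polynomials: x(nP) = φₙ/ψₙ² (`exists_divisionNum_eq`). For the generic point this follows
from the symmetry of the form relating x(P ± Q), x(P) and x(Q); the resulting Somos relations are
polynomial identities and specialise to every point. Consequences are divisibility of the group
(`smul_surjective`), the bound n² on the n-torsion (`ncard_torsion_le`), and, in place of formal
groups, injectivity of reduction (`eq_of_map_eq`).

For φ² = 1, the trace is minus a sum of p quadratic characters. It is divisible by p and at most p
in absolute value, and a polynomial argument excludes ±p, so it vanishes
(`sum_quadraticChar_eq_zero`) and both φP = P and φP = -P have p + 1 solutions. Instead of the
characteristic polynomial of Frobenius, the group theory of `apply_apply_eq_of_nsmul_eq_zero` is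
used: ker(φ² - 1) has order (p + 1)² and is killed by p + 1, so it is the whole (p + 1)-torsion. -/

/-! ### The symmetric triquadratic form of a Weierstrass curve -/

namespace WeierstrassCurve

section Ring

variable {R S : Type*} [CommRing R] [CommRing S] (W : WeierstrassCurve R)

/-- The numerator of `x(P + Q) + x(P - Q)` over `(x(P) - x(Q)) ^ 2`. -/
def addSubSum (x₁ x₂ : R) : R :=
  2 * x₁ * x₂ * (x₁ + x₂) + W.b₂ * x₁ * x₂ + W.b₄ * (x₁ + x₂) + W.b₆

/-- The numerator of `x(P + Q) * x(P - Q)` over `(x(P) - x(Q)) ^ 2`. -/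
def addSubProd (x₁ x₂ : R) : R :=
  x₁ ^ 2 * x₂ ^ 2 - W.b₄ * x₁ * x₂ - W.b₆ * (x₁ + x₂) - W.b₈

/-- The symmetric triquadratic form whose roots in the first variable are the `x`-coordinates of
`P + Q` and `P - Q`. -/
def addSubForm (t x₁ x₂ : R) : R :=
  t ^ 2 * (x₁ - x₂) ^ 2 - t * W.addSubSum x₁ x₂ + W.addSubProd x₁ x₂

lemma addSubForm_swap₁₂ (a b c : R) : W.addSubForm a b c = W.addSubForm b a c := by
  simp only [addSubForm, addSubSum, addSubProd]; ring

lemma addSubForm_swap₂₃ (a b c : R) : W.addSubForm a b c = W.addSubForm a c b := by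
  simp only [addSubForm, addSubSum, addSubProd]; ring

/-- The value at `(x, y)` of the division polynomial `ψ₂`. -/
def psiTwo (x y : R) : R := 2 * y + W.a₁ * x + W.a₃

/-- The value at `x` of the division polynomial `Ψ₂Sq`. -/
def psiTwoSq (x : R) : R := 4 * x ^ 3 + W.b₂ * x ^ 2 + 2 * W.b₄ * x + W.b₆

/-- The value at `x` of the division polynomial `Ψ₃`. -/
def psiThree (x : R) : R :=
  3 * x ^ 4 + W.b₂ * x ^ 3 + 3 * W.b₄ * x ^ 2 + 3 * W.b₆ * x + W.b₈

/-- The value at `x` of the division polynomial `preΨ₄`. -/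
def prePsiFour (x : R) : R :=
  2 * x ^ 6 + W.b₂ * x ^ 5 + 5 * W.b₄ * x ^ 4 + 10 * W.b₆ * x ^ 3 + 10 * W.b₈ * x ^ 2 +
    (W.b₂ * W.b₈ - W.b₄ * W.b₆) * x + (W.b₄ * W.b₈ - W.b₆ ^ 2)

/-- The value at `(x, y)` of the division polynomial `ψₙ`. -/
def divisionSeq (x y : R) (n : ℤ) : R :=
  normEDS (W.psiTwo x y) (W.psiThree x) (W.prePsiFour x) n

/-- The value at `(x, y)` of the polynomial `φₙ`. -/
def divisionNum (x y : R) (n : ℤ) : R :=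
  x * W.divisionSeq x y n ^ 2 - W.divisionSeq x y (n + 1) * W.divisionSeq x y (n - 1)

@[simp] lemma divisionSeq_zero (x y : R) : W.divisionSeq x y 0 = 0 := normEDS_zero ..

@[simp] lemma divisionSeq_one (x y : R) : W.divisionSeq x y 1 = 1 := normEDS_one ..

lemma divisionSeq_two (x y : R) : W.divisionSeq x y 2 = W.psiTwo x y := normEDS_two ..

lemma divisionSeq_three (x y : R) : W.divisionSeq x y 3 = W.psiThree x := normEDS_three ..

lemma divisionSeq_four (x y : R) :
    W.divisionSeq x y 4 = W.prePsiFour x * W.psiTwo x y := normEDS_four ..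

lemma addSubSum_self (x : R) : W.addSubSum x x = W.psiTwoSq x := by
  simp only [addSubSum, psiTwoSq]; ring

lemma psiTwo_sq {x y : R} (h : W.toAffine.Equation x y) :
    W.psiTwo x y ^ 2 = W.psiTwoSq x := by
  rw [Affine.equation_iff] at h
  simp only [psiTwo, psiTwoSq, b₂, b₄, b₆]
  linear_combination 4 * h

lemma mul_psiTwoSq_sub_psiThree (x : R) :
    x * W.psiTwoSq x - W.psiThree x = W.addSubProd x x := by
  simp only [addSubProd, psiTwoSq, psiThree]; ring

lemma prePsiFour_eq (x : R) :
    W.prePsiFour x = (6 * x ^ 2 + W.b₂ * x + W.b₄) * W.psiThree x - W.psiTwoSq x ^ 2 := by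
  have := W.b_relation
  simp only [prePsiFour, psiThree, psiTwoSq]
  linear_combination x ^ 2 * this

end Ring

section Field

open WeierstrassCurve.Affine

variable {F : Type*} [Field F] [DecidableEq F] {W : Affine F}

lemma exists_add_sub_of_X_ne {x₁ y₁ x₂ y₂ : F} (h₁ : W.Nonsingular x₁ y₁)
    (h₂ : W.Nonsingular x₂ y₂) (hx : x₁ ≠ x₂) :
    ∃ x y h x' y' h', Point.some x₁ y₁ h₁ + Point.some x₂ y₂ h₂ = Point.some x y h ∧
      Point.some x₁ y₁ h₁ - Point.some x₂ y₂ h₂ = Point.some x' y' h' ∧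
      (x + x') * (x₁ - x₂) ^ 2 = W.addSubSum x₁ x₂ ∧
      x * x' * (x₁ - x₂) ^ 2 = W.addSubProd x₁ x₂ := by
  have e₁ := (equation_iff ..).mp h₁.1
  have e₂ := (equation_iff ..).mp h₂.1
  have hd : x₁ - x₂ ≠ 0 := sub_ne_zero.mpr hx
  have hsub : Point.some x₁ y₁ h₁ - Point.some x₂ y₂ h₂ = _ :=
    (sub_eq_add_neg _ _).trans (Point.add_of_X_ne (h₂ := (nonsingular_neg ..).mpr h₂) hx)
  refine ⟨_, _, _, _, _, _, Point.add_of_X_ne hx, hsub, ?_, ?_⟩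
  · simp only [addX, slope_of_X_ne hx, negY, addSubSum, b₂, b₄, b₆]
    field_simp
    linear_combination 2 * e₁ + 2 * e₂
  · simp only [addX, slope_of_X_ne hx, negY, addSubProd, b₄, b₆, b₈]
    set l := (y₁ - y₂) / (x₁ - x₂) with hl
    set m := (y₁ - (-y₂ - W.a₁ * x₂ - W.a₃)) / (x₁ - x₂) with hm
    replace hl : l * (x₁ - x₂) = y₁ - y₂ := div_mul_cancel₀ _ hd
    replace hm : m * (x₁ - x₂) = y₁ - (-y₂ - W.a₁ * x₂ - W.a₃) := div_mul_cancel₀ _ hd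
    -- The difference of the curve equations makes the product of the numerators of the two slopes
    -- divisible by x₁ - x₂. The product of the two x-coordinates is then polynomial in l * m * (x₁
    -- - x₂) and (l + m) * (x₁ - x₂).
    have hP : l * m * (x₁ - x₂) =
        x₁ ^ 2 + x₁ * x₂ + x₂ ^ 2 + W.a₂ * (x₁ + x₂) + W.a₄ - W.a₁ * y₁ := by
      refine mul_right_cancel₀ hd ?_
      linear_combination (m * (x₁ - x₂)) * hl + (y₁ - y₂) * hm + e₁ - e₂
    have hS : (l + m) * (x₁ - x₂) = 2 * y₁ + W.a₁ * x₂ + W.a₃ := by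
      linear_combination hl + hm
    trans (l * m * (x₁ - x₂)) ^ 2 + W.a₁ * (l * m * (x₁ - x₂)) * ((l + m) * (x₁ - x₂)) +
      W.a₁ ^ 2 * (l * m * (x₁ - x₂)) * (x₁ - x₂) - (W.a₂ + x₁ + x₂) *
        (((l + m) * (x₁ - x₂)) ^ 2 - 2 * (x₁ - x₂) * (l * m * (x₁ - x₂)) +
          W.a₁ * (x₁ - x₂) * ((l + m) * (x₁ - x₂))) + (W.a₂ + x₁ + x₂) ^ 2 * (x₁ - x₂) ^ 2
    · ring
    · rw [hP, hS]
      linear_combination -(W.a₁ ^ 2 + 4 * (W.a₂ + x₁ + x₂)) * e₁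

lemma exists_add_self {x y : F} (h : W.Nonsingular x y) (hy : W.psiTwo x y ≠ 0) :
    ∃ x' y' h', Point.some x y h + Point.some x y h = Point.some x' y' h' ∧
      x' * W.psiTwoSq x = W.addSubProd x x := by
  have e := (equation_iff ..).mp h.1
  have hne : y ≠ W.negY x y := by
    contrapose! hy
    simp only [negY] at hy
    simp only [psiTwo]
    linear_combination hy
  have hne' : y - W.negY x y ≠ 0 := sub_ne_zero.mpr hne
  refine ⟨_, _, _, Point.add_self_of_Y_ne hne, ?_⟩
  rw [← W.psiTwo_sq h.1, show W.psiTwo x y = y - W.negY x y by simp [psiTwo, negY]; ring]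
  simp only [addX, slope_of_Y_ne rfl hne]
  field_simp
  simp only [negY, addSubProd, b₄, b₆, b₈]
  linear_combination -(W.a₁ ^ 2 + 4 * W.a₂ + 8 * x) * e

end Field

end WeierstrassCurve

/-- A sequence satisfying `w (m + j) * w (m - j) = (X j - X m) * w m ^ 2 * w j ^ 2` for `j = 1`
satisfies it for all `j` in a range if consecutive values of `X` satisfy a symmetric
triquadratic relation. -/
theorem mul_eq_of_symmetric_form {K : Type*} [Field K] {N : ℤ} {w X : ℤ → K} {F : K → K → K → K}
    (hF₁₂ : ∀ a b c, F a b c = F b a c) (hF₂₃ : ∀ a b c, F a b c = F a c b)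
    (hw₀ : w 0 = 0) (hw₁ : w 1 = 1)
    (hw : ∀ i, 0 < i → i < N → w i ≠ 0)
    (h₁ : ∀ i, 1 ≤ i → i < N → w (i + 1) * w (i - 1) = (X 1 - X i) * w i ^ 2)
    (hF : ∀ i, 2 ≤ i → i + 1 < N → ∀ t,
      (t - X (i + 1)) * (t - X (i - 1)) * (X i - X 1) ^ 2 = F t (X i) (X 1))
    (hF' : ∀ t, F t (X 1) (X 1) = w 2 ^ 2 * (X 2 - t)) (j : ℕ) :
    ∀ m : ℤ, 1 ≤ j → j ≤ m → m < N → m + j ≤ N →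
      w (m + j) * w (m - j) = (X j - X m) * w m ^ 2 * w j ^ 2 := by
  induction j using Nat.strong_induction_on with
  | _ j ih =>
    intro m hj hjm hm hmj
    obtain rfl | hjm := hjm.eq_or_lt
    · simp [hw₀]
    rcases Nat.eq_or_lt_of_le hj with rfl | hj
    · simpa [hw₁] using h₁ m (by omega) hm
    have A₁ := h₁ m (by omega) hm
    have B₁ := hF m (by omega) (by omega)
    have n₀ := hw m (by omega) (by omega)
    -- The general step divides by the relation for j - 2, which is unavailable for j = 2; there the
    -- degenerate form `hF'` replaces it.
    rcases Nat.eq_or_lt_of_le (show 2 ≤ j from hj) with rfl | hj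
    · have A₂ := h₁ (m + 1) (by omega) (by omega)
      have A₃ := h₁ (m - 1) (by omega) (by omega)
      rw [show m + 1 + 1 = m + 2 by ring, show m + 1 - 1 = m by ring] at A₂
      rw [show m - 1 + 1 = m by ring, show m - 1 - 1 = m - 2 by ring] at A₃
      have C := B₁ (X 1)
      rw [hF₁₂, hF₂₃, hF₂₃, hF₂₃, hF'] at C
      push_cast
      refine mul_right_cancel₀ (pow_ne_zero 2 n₀) ?_
      linear_combination (w m * w (m - 2)) * A₂ + (X 1 - X (m + 1)) * w (m + 1) ^ 2 * A₃ +
        (X 1 - X (m + 1)) * (X 1 - X (m - 1)) *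
          (w (m + 1) * w (m - 1) + (X 1 - X m) * w m ^ 2) * A₁ + w m ^ 4 * C
    · obtain ⟨i, rfl⟩ : ∃ i, j = i + 1 := ⟨j - 1, by omega⟩
      -- The relations for j - 1 at m + 1 and at m - 1, multiplied together and divided by the one
      -- for j - 2 at m, give the relation for j.
      have I₁ := ih i (by omega) (m + 1) (by omega) (by omega) (by omega) (by push_cast at *; omega)
      have I₂ := ih i (by omega) (m - 1) (by omega) (by push_cast at *; omega) (by omega)
        (by push_cast at *; omega)
      obtain ⟨k, rfl⟩ : ∃ k, i = k + 1 := ⟨i - 1, by omega⟩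
      have I₃ := ih k (by omega) m (by omega) (by push_cast at *; omega) (by omega)
        (by push_cast at *; omega)
      push_cast at *
      set j : ℤ := (k : ℤ) + 1 with hj'
      have A₂ := h₁ j (by omega) (by omega)
      have B₂ := hF j (by omega) (by omega) (X m)
      specialize B₁ (X j)
      -- Symmetry of the form enters here: its value at (X j, X m, X 1) is factored in two ways,
      -- with roots X (m ± 1) and with roots X (j ± 1).
      rw [hF₁₂, ← B₂] at B₁
      rw [show (k : ℤ) = j - 1 by omega] at I₃
      have n₁ := hw (m + j - 1) (by omega) (by omega)
      have n₂ := hw (m - j + 1) (by omega) (by omega)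
      rw [show m + 1 + j = m + j + 1 by ring, show m + 1 - j = m - j + 1 by ring] at I₁
      rw [show m - 1 + j = m + j - 1 by ring, show m - 1 - j = m - j - 1 by ring] at I₂
      rw [show m + (j - 1) = m + j - 1 by ring, show m - (j - 1) = m - j + 1 by ring] at I₃
      rw [show m + (j + 1) = m + j + 1 by ring, show m - (j + 1) = m - j - 1 by ring]
      refine mul_right_cancel₀ (mul_ne_zero n₁ n₂) ?_
      generalize w (m + j + 1) = A at *
      generalize w (m - j - 1) = B at *
      generalize w (m - j + 1) = C at *
      generalize w (m + j - 1) = D at *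
      linear_combination (D * B) * I₁ + (X j - X (m + 1)) * w (m + 1) ^ 2 * w j ^ 2 * I₂ +
        (X j - X (m + 1)) * (X j - X (m - 1)) * w j ^ 4 *
          (w (m + 1) * w (m - 1) + (X 1 - X m) * w m ^ 2) * A₁ + w m ^ 4 * w j ^ 4 * B₁ -
        (X m - X (j + 1)) * (X m - X (j - 1)) * w m ^ 4 *
          (w (j + 1) * w (j - 1) + (X 1 - X j) * w j ^ 2) * A₂ -
        (X (j + 1) - X m) * w m ^ 2 * w (j + 1) ^ 2 * I₃

/-! ### Multiples of a point at which no ψₙ vanishes. -/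

namespace WeierstrassCurve

open WeierstrassCurve.Affine

/-- Taylor expansion around the diagonal. The linear coefficient, half the derivative of `psiTwoSq`,
is the constant of the second Somos relation. -/
lemma addSubSum_eq {R : Type*} [CommRing R] (W : WeierstrassCurve R) (x₁ x₂ : R) :
    W.addSubSum x₁ x₂ = W.psiTwoSq x₂ - (x₂ - x₁) * (6 * x₂ ^ 2 + W.b₂ * x₂ + W.b₄) +
      2 * x₂ * (x₂ - x₁) ^ 2 := by
  simp only [addSubSum, psiTwoSq]; ring

section Generic

variable {K : Type*} [Field K] [DecidableEq K] {W : Affine K}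

lemma add_eq_some_of_X_ne {x₁ y₁ x₂ y₂ : K} (h₁ : W.Nonsingular x₁ y₁)
    (h₂ : W.Nonsingular x₂ y₂) (hx : x₁ ≠ x₂) {x' y' h'}
    (hs : Point.some x₁ y₁ h₁ - Point.some x₂ y₂ h₂ = Point.some (W' := W) x' y' h') :
    ∃ x y h, Point.some x₁ y₁ h₁ + Point.some x₂ y₂ h₂ = Point.some x y h ∧
      ∀ t, (t - x) * (t - x') * (x₁ - x₂) ^ 2 = W.addSubForm t x₁ x₂ := by
  obtain ⟨x, y, h, x'', y'', h'', ha, hs', hsum, hprod⟩ := exists_add_sub_of_X_ne h₁ h₂ hx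
  rw [hs, Point.some.injEq] at hs'
  obtain ⟨rfl, rfl⟩ := hs'
  refine ⟨x, y, h, ha, fun t ↦ ?_⟩
  rw [addSubForm]
  linear_combination hprod - t * hsum

/-- If no `ψₙ` vanishes at a point `(x, y)`, then `n • (x, y)` has `x`-coordinate
`x - ψₙ₊₁ψₙ₋₁ / ψₙ²`. -/
theorem exists_smul_eq_some {x y : K} (h : W.Nonsingular x y)
    (hw : ∀ n : ℤ, 0 < n → W.divisionSeq x y n ≠ 0) (n : ℕ) :
    ∀ k : ℕ, 1 ≤ k → k ≤ n → ∃ x' y' h', k • Point.some x y h = Point.some (W' := W) x' y' h' ∧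
      W.divisionSeq x y (k + 1) * W.divisionSeq x y (k - 1) =
        (x - x') * W.divisionSeq x y k ^ 2 := by
  have hb : W.psiTwo x y ≠ 0 := W.divisionSeq_two x y ▸ hw 2 (by norm_num)
  have hc : W.psiThree x ≠ 0 := W.divisionSeq_three x y ▸ hw 3 (by norm_num)
  have hsq := W.psiTwo_sq h.1
  obtain ⟨x₂, y₂, h₂, hP₂, hx₂⟩ := exists_add_self h hb
  rw [← two_nsmul] at hP₂
  have hx₂' : W.psiThree x = (x - x₂) * W.psiTwo x y ^ 2 := by
    rw [hsq]; linear_combination hx₂ - W.mul_psiTwoSq_sub_psiThree x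
  have hne : x₂ ≠ x := by
    rintro rfl
    exact hc (by rw [hx₂', sub_self, zero_mul])
  induction n with
  | zero => omega
  | succ n ih =>
    intro k hk hkn
    rcases Nat.le_or_eq_of_le_succ hkn with hkn | rfl
    · exact ih k hk hkn
    obtain rfl | rfl | hn : n = 0 ∨ n = 1 ∨ 2 ≤ n := by omega
    · exact ⟨x, y, h, one_smul .., by norm_num⟩
    · refine ⟨x₂, y₂, h₂, hP₂, ?_⟩
      norm_num
      rw [divisionSeq_three, divisionSeq_two, hx₂']
    obtain ⟨xn, yn, hn', hPn, hxn⟩ := ih n (by omega) le_rfl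
    have hxne : xn ≠ x := by
      rintro rfl
      rw [sub_self, zero_mul] at hxn
      exact mul_ne_zero (hw _ (by omega)) (hw _ (by omega)) hxn
    obtain ⟨xp, yp, hp', hPp, hxp⟩ := ih (n - 1) (by omega) (by omega)
    have hsub : Point.some xn yn hn' - Point.some x y h = Point.some xp yp hp' := by
      rw [← hPn, ← hPp, sub_eq_iff_eq_add, ← succ_nsmul, Nat.sub_add_cancel (by omega)]
    obtain ⟨x', y', h', hadd, hform⟩ := add_eq_some_of_X_ne hn' h hxne hsub
    have hPs : (n + 1) • Point.some x y h = Point.some x' y' h' := by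
      rw [succ_nsmul, hPn, hadd]
    refine ⟨x', y', h', hPs, ?_⟩
    -- ψ₄ is an initial value of `normEDS`, so 3P is computed directly; from ψ₅ on the recursion is
    -- available.
    obtain rfl | hn : n = 2 ∨ 3 ≤ n := by omega
    · simp only [Nat.add_one_sub_one, one_smul, Point.some.injEq] at hPp
      obtain ⟨rfl, rfl⟩ := hPp
      rw [hP₂, Point.some.injEq] at hPn
      obtain ⟨rfl, rfl⟩ := hPn
      have hs : (x' + x) * (x₂ - x) ^ 2 = W.addSubSum x₂ x := by
        have h₀ := hform 0
        have h₁ := hform 1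
        simp only [addSubForm] at h₀ h₁
        linear_combination h₀ - h₁
      rw [addSubSum_eq] at hs
      norm_num
      rw [divisionSeq_three, divisionSeq_two, divisionSeq_four, prePsiFour_eq, ← hsq, hx₂']
      rw [← hsq] at hs
      linear_combination W.psiTwo x y ^ 4 * hs
    have hall : ∀ k : ℕ, 1 ≤ k → k ≤ n + 1 →
        ∃ x' y' h', k • Point.some x y h = Point.some (W' := W) x' y' h' := by
      intro k hk hkn
      rcases Nat.le_or_eq_of_le_succ hkn with hkn | rfl
      · obtain ⟨x', y', h', e, -⟩ := ih k hk hkn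
        exact ⟨x', y', h', e⟩
      · exact ⟨x', y', h', hPs⟩
    set w : ℤ → K := W.divisionSeq x y with hwdef
    -- `v` replaces the single value ψₙ₊₂ by the one that the claim requires. It then remains to see
    -- that the required value satisfies the recursion that defines ψₙ₊₂.
    let v : ℤ → K := fun i ↦ if i = n + 2 then (x - x') * w (n + 1) ^ 2 / w n else w i
    let X : ℤ → K := fun i ↦ (i.toNat • Point.some x y h).xRep 0
    have hX : ∀ k : ℕ, X k = (k • Point.some x y h).xRep 0 := fun k ↦ by simp [X]
    have hX₁ : X 1 = x := by simp [X]
    have hX₂ : X 2 = x₂ := by simp [X, hP₂]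
    have hXn : X (n + 1) = x' := by
      have := hX (n + 1)
      rw [hPs] at this
      simpa using this
    have hv : ∀ i : ℤ, i ≠ n + 2 → v i = w i := fun i hi ↦ if_neg hi
    have hvn : v (n + 2) * w n = (x - x') * w (n + 1) ^ 2 := by
      simp only [v, if_true]
      exact div_mul_cancel₀ _ (hw _ (by omega))
    have hC : ∀ i : ℤ, 1 ≤ i → i ≤ n → w (i + 1) * w (i - 1) = (x - X i) * w i ^ 2 := by
      intro i hi hin
      lift i to ℕ using by omega
      obtain ⟨xi, yi, hi', e, hxi⟩ := ih i (by omega) (by omega)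
      rw [hX, e, hxi, Point.xRep_some, Matrix.cons_val_zero]
    have hXne : ∀ i : ℤ, 2 ≤ i → i ≤ n → X i ≠ x := by
      intro i hi hin e
      have := hC i (by omega) hin
      rw [e, sub_self, zero_mul] at this
      exact mul_ne_zero (hw _ (by omega)) (hw _ (by omega)) this
    have key := mul_eq_of_symmetric_form (N := n + 2) (w := v) (X := X) (F := W.addSubForm)
      W.addSubForm_swap₁₂ W.addSubForm_swap₂₃
      (by rw [hv _ (by omega)]; exact W.divisionSeq_zero x y)
      (by rw [hv _ (by omega)]; exact W.divisionSeq_one x y)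
      (fun i hi hin ↦ by rw [hv _ (by omega)]; exact hw i hi)
      (by
        intro i hi hin
        rw [hX₁]
        rcases (show i ≤ n + 1 by omega).eq_or_lt with rfl | hin
        · rw [hXn, hv (n + 1) (by omega), hv (n + 1 - 1) (by omega), add_sub_cancel_right,
            add_assoc]
          exact hvn
        · rw [hv _ (by omega), hv _ (by omega), hv _ (by omega)]
          exact hC i hi (by omega))
      (by
        intro i hi hin t
        lift i to ℕ using by omega
        obtain ⟨a, ya, ha, ea⟩ := hall i (by omega) (by omega)
        obtain ⟨b, yb, hb, eb⟩ := hall (i + 1) (by omega) (by omega)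
        obtain ⟨c, yc, hc, ec⟩ := hall (i - 1) (by omega) (by omega)
        have hXi := hX i
        have hXi₁ := hX (i + 1)
        have hXi₂ := hX (i - 1)
        rw [ea, Point.xRep_some, Matrix.cons_val_zero] at hXi
        rw [eb, Point.xRep_some, Matrix.cons_val_zero] at hXi₁
        rw [ec, Point.xRep_some, Matrix.cons_val_zero] at hXi₂
        rw [Nat.cast_sub (by omega)] at hXi₂
        push_cast at hXi₁ hXi₂
        have hne := hXne i (by omega) (by omega)
        rw [hXi] at hne
        obtain ⟨b', yb', hb', eb', hf⟩ := add_eq_some_of_X_ne ha h hne (x' := c) (y' := yc)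
          (h' := hc) (by
            rw [← ea, ← ec, sub_eq_iff_eq_add, ← succ_nsmul, Nat.sub_add_cancel (by omega)])
        rw [← ea, ← succ_nsmul, eb, Point.some.injEq] at eb'
        rw [hXi, hXi₁, hXi₂, hX₁, eb'.1]
        exact hf t)
      (by
        intro t
        rw [hX₁, hX₂, hv _ (by omega), hwdef, divisionSeq_two, hsq]
        simp only [addSubForm, addSubSum_self]
        linear_combination -hx₂)
    suffices v (n + 2) = w (n + 2) by
      push_cast
      rw [show (n : ℤ) + 1 + 1 = n + 2 by ring, show (n : ℤ) + 1 - 1 = n by ring, ← this, hvn]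
    -- With n + 2 = 2m + 2 or 2m + 3, `key` for the pair (m + 2, m) or (m + 2, m + 1) turns into the
    -- even or odd recursion of `normEDS`.
    rcases Nat.even_or_odd' n with ⟨m, rfl | rfl⟩
    · have k₁ := key m (m + 2) (by omega) (by omega) (by omega) (by push_cast; omega)
      have c₁ := hC m (by omega) (by omega)
      have c₂ := hC (m + 2) (by omega) (by push_cast; omega)
      have r := normEDS_even (W.psiTwo x y) (W.psiThree x) (W.prePsiFour x) (m + 1)
      rw [show (m : ℤ) + 1 - 1 = m by ring, show (m : ℤ) + 1 + 1 = m + 2 by ring,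
        show (m : ℤ) + 1 + 2 = m + 2 + 1 by ring, show (m : ℤ) + 1 - 2 = m - 1 by ring] at r
      change w (2 * (m + 1)) * _ = w m ^ 2 * w (m + 1) * w (m + 2 + 1) -
        w (m - 1) * w (m + 1) * w (m + 2) ^ 2 at r
      rw [hv (m + 2) (by push_cast; omega), hv m (by push_cast; omega),
        show (m : ℤ) + 2 - m = 2 by ring, show (m : ℤ) + 2 + m = (2 * m : ℕ) + 2 by push_cast; ring,
        hv 2 (by push_cast; omega)] at k₁
      rw [show 2 * ((m : ℤ) + 1) = (2 * m : ℕ) + 2 by push_cast; ring,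
        ← divisionSeq_two, ← hwdef] at r
      rw [show (m : ℤ) + 2 - 1 = m + 1 by ring] at c₂
      refine mul_right_cancel₀ (hw 2 (by norm_num)) ?_
      linear_combination k₁ - r + w (m + 2) ^ 2 * c₁ - w m ^ 2 * c₂
    · have k₁ := key (m + 1) (m + 2) (by omega) (by omega) (by push_cast; omega)
        (by push_cast; omega)
      have c₁ := hC (m + 1) (by omega) (by push_cast; omega)
      have c₂ := hC (m + 2) (by omega) (by push_cast; omega)
      have r := normEDS_odd (W.psiTwo x y) (W.psiThree x) (W.prePsiFour x) (m + 1)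
      rw [show (m : ℤ) + 1 - 1 = m by ring, show (m : ℤ) + 1 + 1 = m + 2 by ring,
        show (m : ℤ) + 1 + 2 = m + 2 + 1 by ring] at r
      change w (2 * (m + 1) + 1) = w (m + 2 + 1) * w (m + 1) ^ 3 - w m * w (m + 2) ^ 3 at r
      push_cast at k₁
      rw [hv (m + 2) (by push_cast; omega), hv (m + 1) (by push_cast; omega),
        show (m : ℤ) + 2 - (m + 1) = 1 by ring,
        show (m : ℤ) + 2 + (m + 1) = (2 * m + 1 : ℕ) + 2 by push_cast; ring,
        hv 1 (by push_cast; omega), show w 1 = 1 from W.divisionSeq_one x y] at k₁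
      rw [show 2 * ((m : ℤ) + 1) + 1 = (2 * m + 1 : ℕ) + 2 by push_cast; ring] at r
      rw [show (m : ℤ) + 1 - 1 = m by ring, show (m : ℤ) + 1 + 1 = m + 2 by ring] at c₁
      rw [show (m : ℤ) + 2 - 1 = m + 1 by ring] at c₂
      linear_combination k₁ - r + w (m + 2) ^ 2 * c₁ - w (m + 1) ^ 2 * c₂

/-- The Somos-4 relation at a point where no `ψₙ` vanishes, together with its quadratic
companion. -/
theorem divisionSeq_somos_of_ne_zero {x y : K} (h : W.Nonsingular x y)
    (hw : ∀ n : ℤ, 0 < n → W.divisionSeq x y n ≠ 0) (n : ℕ) (hn : 2 ≤ n) :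
    W.divisionSeq x y (n + 2) * W.divisionSeq x y (n - 2) =
        W.psiTwoSq x * (W.divisionSeq x y (n + 1) * W.divisionSeq x y (n - 1)) -
          W.psiThree x * W.divisionSeq x y n ^ 2 ∧
      W.divisionSeq x y (n + 2) * W.divisionSeq x y (n - 1) ^ 2 +
          W.divisionSeq x y (n - 2) * W.divisionSeq x y (n + 1) ^ 2 +
          W.psiTwoSq x * W.divisionSeq x y n ^ 3 =
        (6 * x ^ 2 + W.b₂ * x + W.b₄) *
          (W.divisionSeq x y (n + 1) * W.divisionSeq x y n * W.divisionSeq x y (n - 1)) := by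
  obtain ⟨a, ya, ha, ea, fa⟩ := exists_smul_eq_some h hw (n + 1) n (by omega) (by omega)
  obtain ⟨b, yb, hb, eb, fb⟩ := exists_smul_eq_some h hw (n + 1) (n + 1) (by omega) (by omega)
  obtain ⟨c, yc, hc, ec, fc⟩ := exists_smul_eq_some h hw (n + 1) (n - 1) (by omega) (by omega)
  push_cast [Nat.cast_sub (show 1 ≤ n by omega)] at fb fc
  rw [show (n : ℤ) + 1 + 1 = n + 2 by ring, show (n : ℤ) + 1 - 1 = n by ring] at fb
  rw [show (n : ℤ) - 1 + 1 = n by ring, show (n : ℤ) - 1 - 1 = n - 2 by ring] at fc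
  have h₀ := hw n (by omega)
  have h₁ := hw (n + 1) (by omega)
  have h₂ := hw (n - 1) (by omega)
  have hne : a ≠ x := by
    rintro rfl
    rw [sub_self, zero_mul] at fa
    exact mul_ne_zero h₁ h₂ fa
  obtain ⟨b', yb', hb', eb', hf⟩ := add_eq_some_of_X_ne ha h hne (x' := c) (y' := yc) (h' := hc) (by
    rw [← ea, ← ec, sub_eq_iff_eq_add, ← succ_nsmul, Nat.sub_add_cancel (by omega)])
  rw [← ea, ← succ_nsmul, eb, Point.some.injEq] at eb'
  rw [← eb'.1] at hf
  generalize W.divisionSeq x y (n + 2) = w₂ at *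
  generalize W.divisionSeq x y (n + 1) = w₁ at *
  generalize W.divisionSeq x y n = w at *
  generalize W.divisionSeq x y (n - 1) = v₁ at *
  generalize W.divisionSeq x y (n - 2) = v₂ at *
  -- The roots of the form are x((n ± 1)P). Their sum yields the quadratic companion; the value of
  -- the form at t = x yields the Somos relation.
  have hs : (b + c) * (a - x) ^ 2 = W.addSubSum a x := by
    have h₀ := hf 0
    have h₁ := hf 1
    simp only [addSubForm] at h₀ h₁
    linear_combination h₀ - h₁
  rw [addSubSum_eq] at hs
  have hx := hf x
  rw [addSubForm_swap₁₂, addSubForm, addSubSum_self, ← mul_psiTwoSq_sub_psiThree] at hx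
  constructor
  · refine mul_right_cancel₀ (pow_ne_zero 2 h₀) ?_
    linear_combination (v₂ * w) * fb + (x - b) * w₁ ^ 2 * fc + (x - b) * (x - c) *
      (w₁ * v₁ + (x - a) * w ^ 2) * fa + w ^ 4 * hx - W.psiTwoSq x * w ^ 2 * fa
  · refine mul_right_cancel₀ h₀ ?_
    linear_combination v₁ ^ 2 * fb + w₁ ^ 2 * fc + (2 * x - b - c) *
      (w₁ * v₁ + (x - a) * w ^ 2) * fa - w ^ 4 * hs - (6 * x ^ 2 + W.b₂ * x + W.b₄) * w ^ 2 * fa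

end Generic

end WeierstrassCurve

/-! ### Values of division polynomials, and the Somos relations over any ring. -/

namespace WeierstrassCurve

open WeierstrassCurve.Affine Polynomial

section Ring

variable {R S : Type*} [CommRing R] [CommRing S] (W : WeierstrassCurve R) (f : R →+* S)

lemma map_psiTwo (x y : R) : (W.map f).psiTwo (f x) (f y) = f (W.psiTwo x y) := by
  simp [psiTwo, map_ofNat f]

lemma map_psiTwoSq (x : R) : (W.map f).psiTwoSq (f x) = f (W.psiTwoSq x) := by
  simp [psiTwoSq, map_ofNat f]

lemma map_psiThree (x : R) : (W.map f).psiThree (f x) = f (W.psiThree x) := by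
  simp [psiThree, map_ofNat f]

lemma map_prePsiFour (x : R) : (W.map f).prePsiFour (f x) = f (W.prePsiFour x) := by
  simp [prePsiFour, map_ofNat f]

lemma map_addSubSum (x x' : R) : (W.map f).addSubSum (f x) (f x') = f (W.addSubSum x x') := by
  simp [addSubSum, map_ofNat f]

lemma map_addSubProd (x x' : R) : (W.map f).addSubProd (f x) (f x') = f (W.addSubProd x x') := by
  simp [addSubProd]

lemma map_divisionSeq (x y : R) (n : ℤ) :
    (W.map f).divisionSeq (f x) (f y) n = f (W.divisionSeq x y n) := by
  simp only [divisionSeq, map_psiTwo, map_psiThree, map_prePsiFour, map_normEDS]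

variable {W}

lemma eval_preΨ (x : R) (n : ℤ) :
    (W.preΨ n).eval x = preNormEDS (W.psiTwoSq x ^ 2) (W.psiThree x) (W.prePsiFour x) n := by
  rw [preΨ, ← coe_evalRingHom, map_preNormEDS]
  congr 1 <;>
  simp only [coe_evalRingHom, Ψ₂Sq, Ψ₃, preΨ₄, psiTwoSq, psiThree, prePsiFour, eval_add,
    eval_mul, eval_pow, eval_C, eval_X, eval_ofNat]

lemma eval_Ψ₂Sq (x : R) : W.Ψ₂Sq.eval x = W.psiTwoSq x := by
  simp only [Ψ₂Sq, psiTwoSq, eval_add, eval_mul, eval_pow, eval_C, eval_X]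

lemma divisionSeq_eq_eval {x y : R} (h : W.toAffine.Equation x y) (n : ℤ) :
    W.divisionSeq x y n = (W.preΨ n).eval x * if Even n then W.psiTwo x y else 1 := by
  rw [divisionSeq, normEDS, eval_preΨ, ← W.psiTwo_sq h, ← pow_mul]

lemma divisionSeq_sq {x y : R} (h : W.toAffine.Equation x y) (n : ℤ) :
    W.divisionSeq x y n ^ 2 = (W.ΨSq n).eval x := by
  rw [divisionSeq_eq_eval h, ΨSq, mul_pow, eval_mul, eval_pow]
  split_ifs
  · rw [W.psiTwo_sq h, eval_Ψ₂Sq]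
  · simp

lemma divisionNum_eq {x y : R} (h : W.toAffine.Equation x y) (n : ℤ) :
    W.divisionNum x y n = (W.Φ n).eval x := by
  rw [divisionNum, divisionSeq_sq h, WeierstrassCurve.Φ, divisionSeq_eq_eval h,
    divisionSeq_eq_eval h]
  simp only [Int.even_add_one, Int.even_sub_one, eval_sub, eval_mul, eval_X]
  split_ifs
  · simp
  · rw [eval_Ψ₂Sq, ← W.psiTwo_sq h]; ring

end Ring

/-! ### The universal pointed Weierstrass curve -/

open MvPolynomial in
/-- The Weierstrass curve over `ℤ[A₁, A₂, A₃, A₄, X, Y]` passing through `(X, Y)`. -/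
noncomputable def universalPointed : WeierstrassCurve (MvPolynomial (Fin 6) ℤ) where
  a₁ := X 0
  a₂ := X 1
  a₃ := X 2
  a₄ := X 3
  a₆ := X 5 ^ 2 + X 0 * X 4 * X 5 + X 2 * X 5 - (X 4 ^ 3 + X 1 * X 4 ^ 2 + X 3 * X 4)

lemma universalPointed_equation :
    universalPointed.toAffine.Equation (MvPolynomial.X 4) (MvPolynomial.X 5) := by
  rw [Affine.equation_iff]
  simp only [universalPointed]
  ring

lemma exists_universalPointed_map {R : Type*} [CommRing R] (W : WeierstrassCurve R) {x y : R}
    (h : W.toAffine.Equation x y) : ∃ f : MvPolynomial (Fin 6) ℤ →+* R,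
      universalPointed.map f = W ∧ f (MvPolynomial.X 4) = x ∧ f (MvPolynomial.X 5) = y := by
  rw [Affine.equation_iff] at h
  refine ⟨MvPolynomial.eval₂Hom (Int.castRingHom R) ![W.a₁, W.a₂, W.a₃, W.a₄, x, y], ?_, ?_, ?_⟩
  · ext <;> simp [universalPointed]
    linear_combination h
  · simp
  · simp

/-- It suffices to specialise to y² = x³ + 1 over ℝ, at a positive x that is not a root of `preΨ n`;
then y > 0, so ψ₂ does not vanish either. -/
lemma universalPointed_divisionSeq_ne_zero (n : ℤ) (hn : 0 < n) :
    universalPointed.divisionSeq (MvPolynomial.X 4) (MvPolynomial.X 5) n ≠ 0 := by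
  let W : WeierstrassCurve ℝ := ⟨0, 0, 0, 0, 1⟩
  have hpre : W.preΨ n ≠ 0 := W.preΨ_ne_zero (by exact_mod_cast hn.ne')
  obtain ⟨x, hx, hx₀⟩ : ∃ x : ℝ, x ∉ (W.preΨ n).roots.toFinset ∧ 0 < x := by
    obtain ⟨x, hx, hx'⟩ := (Set.Ioi_infinite (0 : ℝ)).exists_notMem_finset (W.preΨ n).roots.toFinset
    exact ⟨x, hx', hx⟩
  have hpos : 0 < x ^ 3 + 1 := by positivity
  have heq : W.toAffine.Equation x √(x ^ 3 + 1) := by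
    rw [Affine.equation_iff]
    simp [W, Real.sq_sqrt hpos.le]
  obtain ⟨f, hf, h₁, h₂⟩ := exists_universalPointed_map W heq
  intro h
  have := map_divisionSeq universalPointed f (MvPolynomial.X 4) (MvPolynomial.X 5) n
  rw [h, map_zero, hf, h₁, h₂, divisionSeq_eq_eval heq] at this
  refine mul_ne_zero (fun h ↦ hx ?_) ?_ this
  · simpa [hpre] using h
  · split_ifs
    · simpa [psiTwo, W] using (Real.sqrt_pos.mpr hpos).ne'
    · exact one_ne_zero

/-- The Somos-4 relation for division polynomials, together with its quadratic companion. -/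
theorem divisionSeq_somos {R : Type*} [CommRing R] (W : WeierstrassCurve R) {x y : R}
    (h : W.toAffine.Equation x y) (n : ℕ) (hn : 2 ≤ n) :
    W.divisionSeq x y (n + 2) * W.divisionSeq x y (n - 2) =
        W.psiTwoSq x * (W.divisionSeq x y (n + 1) * W.divisionSeq x y (n - 1)) -
          W.psiThree x * W.divisionSeq x y n ^ 2 ∧
      W.divisionSeq x y (n + 2) * W.divisionSeq x y (n - 1) ^ 2 +
          W.divisionSeq x y (n - 2) * W.divisionSeq x y (n + 1) ^ 2 +
          W.psiTwoSq x * W.divisionSeq x y n ^ 3 =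
        (6 * x ^ 2 + W.b₂ * x + W.b₄) *
          (W.divisionSeq x y (n + 1) * W.divisionSeq x y n * W.divisionSeq x y (n - 1)) := by
  classical
  obtain ⟨f, rfl, rfl, rfl⟩ := exists_universalPointed_map W h
  -- The universal point over the fraction field satisfies the nonvanishing hypothesis. The identity
  -- descends to the polynomial ring and maps to every pointed curve.
  let g := algebraMap (MvPolynomial (Fin 6) ℤ) (FractionRing (MvPolynomial (Fin 6) ℤ))
  have hg : Function.Injective g := IsFractionRing.injective _ _
  have hw : ∀ n : ℤ, 0 < n →
      (universalPointed.map g).divisionSeq (g (MvPolynomial.X 4)) (g (MvPolynomial.X 5)) n ≠ 0 :=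
    fun n hn ↦ by
      rw [map_divisionSeq]
      exact (map_ne_zero_iff g hg).mpr (universalPointed_divisionSeq_ne_zero n hn)
  have heq : (universalPointed.map g).toAffine.Equation (g (MvPolynomial.X 4))
      (g (MvPolynomial.X 5)) := universalPointed_equation.map g
  have hns : (universalPointed.map g).toAffine.Nonsingular (g (MvPolynomial.X 4))
      (g (MvPolynomial.X 5)) := by
    rw [Affine.nonsingular_iff]
    refine ⟨heq, Or.inr fun hy ↦ hw 2 (by norm_num) ?_⟩
    rw [divisionSeq_two, psiTwo]
    linear_combination hy
  obtain ⟨h₁, h₂⟩ := divisionSeq_somos_of_ne_zero hns hw n hn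
  simp only [map_divisionSeq, map_psiTwoSq, map_psiThree, map_b₂, map_b₄] at h₁ h₂ ⊢
  have e₁ := hg (by simpa only [map_add, map_sub, map_mul, map_pow] using h₁ :
    g (universalPointed.divisionSeq (MvPolynomial.X 4) (MvPolynomial.X 5) (n + 2) *
      universalPointed.divisionSeq (MvPolynomial.X 4) (MvPolynomial.X 5) (n - 2)) =
    g (universalPointed.psiTwoSq (MvPolynomial.X 4) *
      (universalPointed.divisionSeq (MvPolynomial.X 4) (MvPolynomial.X 5) (n + 1) *
        universalPointed.divisionSeq (MvPolynomial.X 4) (MvPolynomial.X 5) (n - 1)) -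
      universalPointed.psiThree (MvPolynomial.X 4) *
        universalPointed.divisionSeq (MvPolynomial.X 4) (MvPolynomial.X 5) n ^ 2))
  have e₂ := hg (by simpa only [map_add, map_sub, map_mul, map_pow, map_ofNat] using h₂ :
    g (universalPointed.divisionSeq (MvPolynomial.X 4) (MvPolynomial.X 5) (n + 2) *
        universalPointed.divisionSeq (MvPolynomial.X 4) (MvPolynomial.X 5) (n - 1) ^ 2 +
      universalPointed.divisionSeq (MvPolynomial.X 4) (MvPolynomial.X 5) (n - 2) *
        universalPointed.divisionSeq (MvPolynomial.X 4) (MvPolynomial.X 5) (n + 1) ^ 2 +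
      universalPointed.psiTwoSq (MvPolynomial.X 4) *
        universalPointed.divisionSeq (MvPolynomial.X 4) (MvPolynomial.X 5) n ^ 3) =
    g ((6 * MvPolynomial.X 4 ^ 2 + universalPointed.b₂ * MvPolynomial.X 4 + universalPointed.b₄) *
      (universalPointed.divisionSeq (MvPolynomial.X 4) (MvPolynomial.X 5) (n + 1) *
        universalPointed.divisionSeq (MvPolynomial.X 4) (MvPolynomial.X 5) n *
        universalPointed.divisionSeq (MvPolynomial.X 4) (MvPolynomial.X 5) (n - 1))))
  constructor
  · simpa only [map_add, map_sub, map_mul, map_pow] using congrArg f e₁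
  · simpa only [map_add, map_sub, map_mul, map_pow, map_ofNat] using congrArg f e₂

end WeierstrassCurve

/-! ### The x-coordinate of nP for every nonsingular point. -/

namespace WeierstrassCurve

open WeierstrassCurve.Affine

lemma eval_addSubMap {R : Type*} [CommRing R] (W : WeierstrassCurve R) (s t u : R) :
    (fun i ↦ (addSubMap W i).eval ![s, t, u]) =
      ![s ^ 2 - W.b₄ * s * u - W.b₆ * t * u - W.b₈ * u ^ 2,
        2 * t * s + W.b₂ * s * u + W.b₄ * t * u + W.b₆ * u ^ 2, t ^ 2 - 4 * s * u] := by
  ext i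
  fin_cases i <;> simp [addSubMap]

/-- At a 2-torsion point this value is the square of the X-derivative of the equation, the only
partial derivative left to be nonzero. -/
lemma addSubProd_self_ne_zero {F : Type*} [Field F] {W : Affine F} {x y : F}
    (h : W.Nonsingular x y) (hy : W.psiTwo x y = 0) :
    W.addSubProd x x ≠ 0 := by
  rw [nonsingular_iff', equation_iff] at h
  obtain ⟨e, h⟩ := h
  have h : W.a₁ * y - (3 * x ^ 2 + 2 * W.a₂ * x + W.a₄) ≠ 0 := h.resolve_right (not_not.mpr hy)
  convert pow_ne_zero 2 h using 1
  rw [psiTwo] at hy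
  simp only [addSubProd, b₄, b₆, b₈]
  linear_combination (-(W.a₂ + 2 * x) * (2 * y + W.a₁ * x + W.a₃) - W.a₁ *
    (W.a₁ * y - (3 * x ^ 2 + 2 * W.a₂ * x + W.a₄))) * hy + (W.a₁ ^ 2 + 4 * W.a₂ + 8 * x) * e

/-- Cancellation of a common linear factor from products of binary linear forms: a point of ℙ¹ is
recovered from an unordered pair once the other member is known. -/
lemma eq_mul_of_sym2_eq {F : Type*} [Field F] {a b p q p' q' c : F} (h : a ≠ 0 ∨ b ≠ 0)
    (h₀ : p * a = c * (p' * a))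
    (h₁ : p * b + q * a = c * (p' * b + q' * a)) (h₂ : q * b = c * (q' * b)) :
    p = c * p' ∧ q = c * q' := by
  by_cases hb : b = 0
  · have ha := h.resolve_right (not_not.mpr hb)
    subst hb
    refine ⟨mul_right_cancel₀ ha ?_, mul_right_cancel₀ ha ?_⟩
    · linear_combination h₀
    · linear_combination h₁
  · have hq : q = c * q' := mul_right_cancel₀ hb (by linear_combination h₂)
    refine ⟨mul_right_cancel₀ hb ?_, hq⟩
    linear_combination h₁ - a * hq

section

variable {F : Type*} [Field F] [DecidableEq F] {W : Affine F}

lemma exists_addSubMap_self {x y : F} (h : W.Nonsingular x y) :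
    ∃ c : F, c ≠ 0 ∧ W.addSubProd x x = c * (Point.some x y h + Point.some x y h).xRep 0 ∧
      W.psiTwoSq x = c * (Point.some x y h + Point.some x y h).xRep 1 := by
  by_cases hy : W.psiTwo x y = 0
  · refine ⟨_, addSubProd_self_ne_zero h hy, ?_⟩
    have : y = W.negY x y := by
      rw [psiTwo] at hy
      rw [negY]
      linear_combination hy
    rw [Point.add_self_of_Y_eq this, ← W.psiTwo_sq h.1, hy]
    simp
  · obtain ⟨x', y', h', e, hx⟩ := exists_add_self h hy
    refine ⟨W.psiTwoSq x, ?_, ?_⟩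
    · rw [← W.psiTwo_sq h.1]
      exact pow_ne_zero 2 hy
    · rw [e]
      simp [← hx, mul_comm]

/-- The map `addSubMap` sends the coordinates of `{x(P), x(Q)}` in `Sym² ℙ¹` to those of
`{x(P + Q), x(P - Q)}`. -/
theorem exists_addSubMap_sym2x (P Q : W.Point) :
    ∃ c : F, c ≠ 0 ∧ (fun i ↦ (addSubMap W i).eval (P.sym2x Q)) = c • (P + Q).sym2x (P - Q) := by
  rcases P with _ | ⟨x₁, y₁, h₁⟩
  · rw [← Point.zero_def, zero_add, zero_sub, Point.sym2x_neg_right]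
    refine ⟨1, one_ne_zero, ?_⟩
    rcases Q with _ | ⟨x₂, y₂, h₂⟩
    · rw [← Point.zero_def, Point.sym2x_zero_zero, eval_addSubMap]
      simp
    · rw [Point.sym2x_zero_some, Point.sym2x_some_some, eval_addSubMap]
      ext i
      fin_cases i <;> simp <;> ring
  rcases Q with _ | ⟨x₂, y₂, h₂⟩
  · rw [← Point.zero_def, add_zero, sub_zero]
    refine ⟨1, one_ne_zero, ?_⟩
    rw [Point.sym2x_some_zero, Point.sym2x_some_some, eval_addSubMap]
    ext i
    fin_cases i <;> simp <;> ring
  -- If the x-coordinates agree, one of P ± Q is zero and the other is ±2P.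
  by_cases hx : x₁ = x₂
  · obtain ⟨c, hc, e₀, e₁⟩ := exists_addSubMap_self h₁
    refine ⟨c, hc, ?_⟩
    rw [Point.sym2x_some_some]
    subst hx
    trans ![c * (Point.some x₁ y₁ h₁ + Point.some x₁ y₁ h₁).xRep 0,
      c * (Point.some x₁ y₁ h₁ + Point.some x₁ y₁ h₁).xRep 1, 0]
    · rw [← e₀, ← e₁, eval_addSubMap]
      ext i
      fin_cases i <;> simp [addSubProd, psiTwoSq] <;> ring
    · obtain e | e := Point.X_eq_iff (h₁ := h₁) (h₂ := h₂) |>.mp rfl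
      · rw [← e, sub_self, Point.sym2x]
        ext i
        fin_cases i <;> simp
      · rw [e]
        generalize Point.some x₁ y₂ h₂ = Q
        rw [sub_eq_add_neg (-Q), ← neg_add, neg_add_cancel, Point.xRep_neg, Point.sym2x_neg_right,
          Point.sym2x]
        ext i
        fin_cases i <;> simp
  · obtain ⟨x, y, h, x', y', h', ha, hs, hsum, hprod⟩ := exists_add_sub_of_X_ne h₁ h₂ hx
    refine ⟨(x₁ - x₂) ^ 2, pow_ne_zero 2 (sub_ne_zero.mpr hx), ?_⟩
    rw [ha, hs, Point.sym2x_some_some, Point.sym2x_some_some, eval_addSubMap]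
    rw [addSubSum] at hsum
    rw [addSubProd] at hprod
    ext i
    fin_cases i
    · simp
      linear_combination -hprod
    · simp
      linear_combination -hsum
    · simp
      ring

/-- The `x`-coordinate of `n • (x, y)` is `(φₙ : ψₙ²)`. -/
theorem exists_divisionNum_eq {x y : F} (h : W.Nonsingular x y) (n : ℕ) :
    (∃ c : F, c ≠ 0 ∧ W.divisionNum x y n = c * (n • Point.some x y h).xRep 0 ∧
      W.divisionSeq x y n ^ 2 = c * (n • Point.some x y h).xRep 1) ∧
    ∃ c : F, c ≠ 0 ∧ W.divisionNum x y (n + 1) = c * ((n + 1) • Point.some x y h).xRep 0 ∧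
      W.divisionSeq x y (n + 1) ^ 2 = c * ((n + 1) • Point.some x y h).xRep 1 := by
  have h₁ : ∃ c : F, c ≠ 0 ∧ W.divisionNum x y 1 = c * (1 • Point.some x y h).xRep 0 ∧
      W.divisionSeq x y 1 ^ 2 = c * (1 • Point.some x y h).xRep 1 :=
    ⟨1, one_ne_zero, by simp [divisionNum], by simp⟩
  -- Two consecutive multiples are carried because P ± Q is known only as an unordered pair: x((n +
  -- 2)P) is what remains of {x((n + 2)P), x(nP)} after x(nP) is cancelled. The scalars allow for
  -- multiples equal to zero.
  induction n with
  | zero =>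
    refine ⟨⟨1, one_ne_zero, ?_, by simp⟩, by simpa using h₁⟩
    simp [divisionNum, divisionSeq]
  | succ n ih =>
    push_cast
    refine ⟨ih.2, ?_⟩
    rcases Nat.eq_zero_or_pos n with rfl | hn
    · obtain ⟨c, hc, e₀, e₁⟩ := exists_addSubMap_self h
      refine ⟨c, hc, ?_⟩
      norm_num
      rw [two_nsmul, ← e₀, ← e₁, divisionNum]
      norm_num
      rw [divisionSeq_two, divisionSeq_three, W.psiTwo_sq h.1, mul_psiTwoSq_sub_psiThree]
      exact ⟨rfl, rfl⟩
    obtain ⟨⟨c₀, hc₀, e₀, f₀⟩, c₁, hc₁, e₁, f₁⟩ := ih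
    obtain ⟨r, s⟩ := divisionSeq_somos W h.1 (n + 1) (by omega)
    obtain ⟨c, hc, H⟩ := exists_addSubMap_sym2x ((n + 1) • Point.some x y h) (Point.some x y h)
    rw [show (n + 1) • Point.some x y h - Point.some x y h = n • Point.some x y h by
      rw [succ_nsmul, add_sub_cancel_right], ← succ_nsmul, Point.sym2x, Point.xRep_some] at H
    simp only [Matrix.cons_val_zero, Matrix.cons_val_one, mul_one] at H
    rw [eval_addSubMap, Point.sym2x] at H
    have H₀ := congrFun H 0
    have H₁ := congrFun H 1
    have H₂ := congrFun H 2
    simp only [Pi.smul_apply, smul_eq_mul, Matrix.cons_val] at H₀ H₁ H₂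
    clear H
    have hne : ((n • Point.some x y h).xRep 0 ≠ 0 ∨ (n • Point.some x y h).xRep 1 ≠ 0) := by
      by_contra! hz
      refine (n • Point.some x y h).xRep_ne_zero (funext fun i ↦ ?_)
      fin_cases i
      exacts [hz.1, hz.2]
    refine ⟨c₁ ^ 2 * c * c₀⁻¹, mul_ne_zero (mul_ne_zero (pow_ne_zero 2 hc₁) hc)
      (inv_ne_zero hc₀), ?_⟩
    push_cast at r s
    rw [show (n : ℤ) + 1 + 2 = n + 3 by ring, show (n : ℤ) + 1 - 2 = n - 1 by ring,
      show (n : ℤ) + 1 + 1 = n + 2 by ring, show (n : ℤ) + 1 - 1 = n by ring] at r s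
    rw [divisionNum, show (n : ℤ) + 1 + 1 = n + 2 by ring, show (n : ℤ) + 1 - 1 = n by ring] at e₁
    rw [divisionNum] at e₀
    rw [divisionNum, show (n : ℤ) + 1 + 1 + 1 = n + 3 by ring,
      show (n : ℤ) + 1 + 1 - 1 = n + 1 by ring, show (n : ℤ) + 1 + 1 = n + 2 by ring]
    generalize (n • Point.some x y h).xRep 0 = p at *
    generalize (n • Point.some x y h).xRep 1 = q at *
    generalize ((n + 1) • Point.some x y h).xRep 0 = s₁ at *
    generalize ((n + 1) • Point.some x y h).xRep 1 = t₁ at *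
    generalize ((n + 1 + 1) • Point.some x y h).xRep 0 = s₂ at *
    generalize ((n + 1 + 1) • Point.some x y h).xRep 1 = t₂ at *
    generalize W.divisionSeq x y (n - 1) = w₀ at *
    generalize W.divisionSeq x y n = w₁ at *
    generalize W.divisionSeq x y (n + 1) = w₂ at *
    generalize W.divisionSeq x y (n + 2) = w₃ at *
    generalize W.divisionSeq x y (n + 3) = w₄ at *
    replace H₀ : (c₁ * s₁) ^ 2 * x ^ 2 - W.b₄ * (c₁ * s₁) * x * (c₁ * t₁) -
        W.b₆ * (c₁ * s₁ + c₁ * t₁ * x) * (c₁ * t₁) - W.b₈ * (c₁ * t₁) ^ 2 =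
        c₁ ^ 2 * c * s₂ * p := by
      linear_combination c₁ ^ 2 * H₀
    replace H₁ : 2 * (c₁ * s₁ + c₁ * t₁ * x) * (c₁ * s₁ * x) + W.b₂ * (c₁ * s₁ * x) * (c₁ * t₁) +
        W.b₄ * (c₁ * s₁ + c₁ * t₁ * x) * (c₁ * t₁) + W.b₆ * (c₁ * t₁) ^ 2 =
        c₁ ^ 2 * c * (s₂ * q + t₂ * p) := by
      linear_combination c₁ ^ 2 * H₁
    replace H₂ : (c₁ * s₁ - c₁ * t₁ * x) ^ 2 = c₁ ^ 2 * c * (t₂ * q) := by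
      linear_combination c₁ ^ 2 * H₂
    rw [← e₁, ← f₁] at H₀ H₁ H₂
    have key : c₀ * (c₁ ^ 2 * c * c₀⁻¹) = c₁ ^ 2 * c := by field_simp
    generalize c₁ ^ 2 * c * c₀⁻¹ = C at *
    rw [psiTwoSq] at r s
    rw [psiThree] at r
    -- The Somos relations say that the pairs (φ : ψ²) satisfy the same `Sym²` identities as the
    -- x-coordinates.
    refine eq_mul_of_sym2_eq hne ?_ ?_ ?_ <;> refine mul_left_cancel₀ hc₀ ?_
    · linear_combination -(x * w₃ ^ 2 - w₄ * w₂) * e₀ + w₂ ^ 2 * r - x * w₂ * s + H₀ -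
        s₂ * p * key
    · linear_combination -(x * w₃ ^ 2 - w₄ * w₂) * f₀ - w₃ ^ 2 * e₀ - w₂ * s + H₁ -
        (s₂ * q + t₂ * p) * key
    · linear_combination -w₃ ^ 2 * f₀ + H₂ - t₂ * q * key

theorem smul_some_eq_zero_iff {x y : F} (h : W.Nonsingular x y) (n : ℕ) :
    n • Point.some x y h = 0 ↔ (W.ΨSq n).eval x = 0 := by
  obtain ⟨⟨c, hc, -, e⟩, -⟩ := exists_divisionNum_eq h n
  rw [← divisionSeq_sq h.1, e]
  rcases n • Point.some x y h with _ | ⟨x', y', h'⟩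
  · simp [← Point.zero_def]
  · simp [hc]

theorem eval_Φ_eq_of_smul_eq_some {x y : F} (h : W.Nonsingular x y) {n : ℕ} {x' y' h'}
    (e : n • Point.some x y h = Point.some (W' := W) x' y' h') :
    (W.Φ n).eval x = x' * (W.ΨSq n).eval x := by
  obtain ⟨⟨c, hc, e₀, e₁⟩, -⟩ := exists_divisionNum_eq h n
  rw [← divisionSeq_sq h.1, ← divisionNum_eq h.1, e₀, e₁, e]
  simp [mul_comm]

/-- Coprimality of numerator and denominator at points of the curve: up to a nonzero scalar they are
homogeneous coordinates of a point of ℙ¹. -/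
theorem eval_Φ_ne_zero_or_eval_ΨSq_ne_zero {x y : F} (h : W.Nonsingular x y) (n : ℕ) :
    (W.Φ n).eval x ≠ 0 ∨ (W.ΨSq n).eval x ≠ 0 := by
  obtain ⟨⟨c, hc, e₀, e₁⟩, -⟩ := exists_divisionNum_eq h n
  rw [← divisionSeq_sq h.1, ← divisionNum_eq h.1, e₀, e₁]
  rcases n • Point.some x y h with _ | ⟨x', y', h'⟩
  · simp [← Point.zero_def, hc]
  · simp [hc]

end

end WeierstrassCurve

/-! ### Divisibility of the group of points and the size of its torsion. -/

namespace WeierstrassCurve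

open WeierstrassCurve.Affine Polynomial

section

variable {F : Type*} [Field F] [DecidableEq F] {W : Affine F}

lemma exists_equation {F : Type*} [Field F] [IsAlgClosed F] (W : Affine F) (x : F) :
    ∃ y, W.Equation x y := by
  obtain ⟨y, hy⟩ := IsAlgClosed.exists_root
    (C 1 * X ^ 2 + C (W.a₁ * x + W.a₃) * X + C (-(x ^ 3 + W.a₂ * x ^ 2 + W.a₄ * x + W.a₆)))
    (by rw [degree_quadratic one_ne_zero]; norm_num)
  refine ⟨y, (equation_iff ..).mpr ?_⟩
  simp only [IsRoot, eval_add, eval_mul, eval_C, eval_pow, eval_X] at hy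
  linear_combination hy

/-- Multiplication by a positive integer on an elliptic curve over an algebraically closed field
is surjective. -/
theorem smul_surjective [IsAlgClosed F] [W.IsElliptic] {n : ℕ} (hn : 0 < n) (Q : W.Point) :
    ∃ P : W.Point, n • P = Q := by
  rcases Q with _ | ⟨a, b, hab⟩
  · exact ⟨0, smul_zero _⟩
  -- φₙ is monic of degree n² and ψₙ² has smaller degree, so φₙ - aψₙ² has a root x. A point P above
  -- it has x(nP) = a, whence nP = ±Q.
  have hcoeff : (W.Φ n - C a * W.ΨSq n).coeff (n ^ 2) = 1 := by
    have h₁ := W.coeff_Φ n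
    rw [Int.natAbs_natCast] at h₁
    rw [coeff_sub, h₁, coeff_C_mul, coeff_eq_zero_of_natDegree_lt, mul_zero, sub_zero]
    refine (W.natDegree_ΨSq_le n).trans_lt ?_
    rw [Int.natAbs_natCast]
    exact Nat.sub_lt (by positivity) one_pos
  obtain ⟨x, hx⟩ := IsAlgClosed.exists_root (W.Φ n - C a * W.ΨSq n) (by
    intro h
    have : n ^ 2 ≤ (W.Φ n - C a * W.ΨSq n).natDegree :=
      le_natDegree_of_ne_zero (hcoeff ▸ one_ne_zero)
    rw [natDegree_eq_zero_iff_degree_le_zero.mpr h.le] at this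
    have : 0 < n ^ 2 := by positivity
    omega)
  obtain ⟨y, hy⟩ := exists_equation W x
  have h : W.Nonsingular x y := equation_iff_nonsingular.mp hy
  have hx' : (W.Φ n).eval x = a * (W.ΨSq n).eval x := by
    rwa [IsRoot, eval_sub, eval_mul, eval_C, sub_eq_zero] at hx
  have hne : (W.ΨSq n).eval x ≠ 0 := by
    intro h₀
    rw [h₀, mul_zero] at hx'
    exact (eval_Φ_ne_zero_or_eval_ΨSq_ne_zero h n).elim (· hx') (· h₀)
  rcases hP : n • Point.some x y h with _ | ⟨x', y', h'⟩
  · exact absurd ((smul_some_eq_zero_iff h n).mp hP) hne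
  · have e := eval_Φ_eq_of_smul_eq_some h hP
    rw [hx'] at e
    obtain rfl := mul_right_cancel₀ hne e
    rcases Point.X_eq_iff (h₁ := hab) (h₂ := h') |>.mp rfl with e | e
    · exact ⟨_, hP.trans e.symm⟩
    · exact ⟨-Point.some x y h, by rw [smul_neg, hP, e]⟩

omit [DecidableEq F] in
lemma ncard_fiber_le (x : F) :
    {P : W.Point | ∃ y h, P = Point.some x y h}.Finite ∧
      {P : W.Point | ∃ y h, P = Point.some x y h}.ncard ≤ 2 := by
  rcases {P : W.Point | ∃ y h, P = Point.some x y h}.eq_empty_or_nonempty with h | ⟨_, y, h, rfl⟩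
  · rw [h]; simp
  have hs : {P : W.Point | ∃ y h, P = Point.some x y h} ⊆
      {Point.some x y h, -Point.some x y h} := by
    rintro _ ⟨y', h', rfl⟩
    exact Point.X_eq_iff.mp rfl
  exact ⟨(Set.toFinite _).subset hs, (Set.ncard_le_ncard hs).trans
    ((Set.ncard_insert_le _ _).trans (by simp))⟩

omit [DecidableEq F] in
lemma ncard_fiber_le_one {x : F} (hx : W.psiTwoSq x = 0) :
    {P : W.Point | ∃ y h, P = Point.some x y h}.Finite ∧
      {P : W.Point | ∃ y h, P = Point.some x y h}.ncard ≤ 1 := by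
  have hs : {P : W.Point | ∃ y h, P = Point.some x y h}.Subsingleton := by
    rintro _ ⟨y, h, rfl⟩ _ ⟨y', h', rfl⟩
    have := Point.X_eq_iff (h₁ := h) (h₂ := h') |>.mp rfl
    rw [← W.psiTwo_sq h'.1, sq_eq_zero_iff, psiTwo] at hx
    have : -Point.some x y' h' = Point.some x y' h' := by
      rw [Point.neg_some, Point.some.injEq, negY]
      exact ⟨rfl, by linear_combination -hx⟩
    simp_all
  exact ⟨hs.finite, (Set.ncard_le_one hs.finite).mpr fun _ h _ h' ↦ hs h h'⟩

/-- For even `n` invertible in `F` there are at most `n ^ 2` points killed by `n`. -/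
theorem ncard_torsion_le {n : ℕ} (hn : Even n) (hnF : (n : F) ≠ 0) :
    {P : W.Point | n • P = 0}.Finite ∧ {P : W.Point | n • P = 0}.ncard ≤ n ^ 2 := by
  have hn₀ : n ≠ 0 := by rintro rfl; simp at hnF
  have h2 : (2 : F) ≠ 0 := by
    obtain ⟨m, rfl⟩ := hn
    intro h
    apply hnF
    push_cast
    linear_combination (m : F) * h
  have hpre : W.preΨ' n ≠ 0 := W.preΨ'_ne_zero hnF
  have hΨ₂ : W.Ψ₂Sq ≠ 0 := W.Ψ₂Sq_ne_zero (by
    rw [show (4 : F) = 2 * 2 by norm_num]; exact mul_ne_zero h2 h2)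
  let S : F → Set W.Point := fun x ↦ {P | ∃ y h, P = Point.some x y h}
  let A := W.Ψ₂Sq.roots.toFinset
  let B := (W.preΨ' n).roots.toFinset
  have hA : ∀ x ∈ A, (S x).Finite ∧ (S x).ncard ≤ 1 := fun x hx ↦
    ncard_fiber_le_one (by simpa [A, hΨ₂, eval_Ψ₂Sq] using hx)
  have hB : ∀ x ∈ B, (S x).Finite ∧ (S x).ncard ≤ 2 := fun x _ ↦ ncard_fiber_le x
  -- The count is 1 for the zero point, one point for each of at most 3 roots of Ψ₂², and two for
  -- each of at most (n² - 4)/2 roots of `preΨ' n`: in total n².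
  have hsub : {P : W.Point | n • P = 0} ⊆ {0} ∪ ((⋃ x ∈ A, S x) ∪ ⋃ x ∈ B, S x) := by
    rintro (_ | ⟨x, y, h⟩) hP
    · exact Or.inl rfl
    · refine Or.inr ?_
      rw [Set.mem_ofPred_eq, smul_some_eq_zero_iff, ΨSq_ofNat, if_pos hn, eval_mul, eval_pow,
        mul_eq_zero, sq_eq_zero_iff] at hP
      rcases hP with hP | hP
      · exact Or.inr (Set.mem_biUnion (show x ∈ B by simpa [B, hpre] using hP) ⟨y, h, rfl⟩)
      · exact Or.inl (Set.mem_biUnion (show x ∈ A by simpa [A, hΨ₂] using hP) ⟨y, h, rfl⟩)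
  have hAf : (⋃ x ∈ A, S x).Finite := A.finite_toSet.biUnion fun x hx ↦ (hA x hx).1
  have hBf : (⋃ x ∈ B, S x).Finite := B.finite_toSet.biUnion fun x hx ↦ (hB x hx).1
  have hf := (Set.finite_singleton (0 : W.Point)).union (hAf.union hBf)
  refine ⟨hf.subset hsub, (Set.ncard_le_ncard hsub hf).trans ?_⟩
  have hAc : A.card ≤ 3 := (Multiset.toFinset_card_le _).trans
    ((card_roots' _).trans W.natDegree_Ψ₂Sq_le)
  have hBc : B.card ≤ (n ^ 2 - 4) / 2 := by
    refine (Multiset.toFinset_card_le _).trans ((card_roots' _).trans ?_)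
    simpa [hn] using W.natDegree_preΨ'_le n
  have h₁ : (⋃ x ∈ A, S x).ncard ≤ A.card * 1 := by
    refine (A.set_ncard_biUnion_le S).trans (Finset.sum_le_card_nsmul _ _ _ fun x hx ↦ (hA x hx).2)
  have h₂ : (⋃ x ∈ B, S x).ncard ≤ B.card * 2 := by
    refine (B.set_ncard_biUnion_le S).trans (Finset.sum_le_card_nsmul _ _ _ fun x hx ↦ (hB x hx).2)
  have h₃ : 4 ≤ n ^ 2 := by
    obtain ⟨m, rfl⟩ := hn
    nlinarith [show 1 ≤ m by omega]
  calc _ ≤ 1 + (A.card * 1 + B.card * 2) := (Set.ncard_union_le _ _).trans <| by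
        rw [Set.ncard_singleton]
        gcongr
        exact (Set.ncard_union_le _ _).trans (add_le_add h₁ h₂)
    _ ≤ n ^ 2 := by omega

end

/-! ### Reduction of torsion points -/

section Reduction

variable {B K Ω : Type*} [CommRing B] [Field K] [DecidableEq K] [Algebra B K]
  [IsIntegrallyClosedIn B K] [Field Ω] [DecidableEq Ω] {W : WeierstrassCurve B} {θ : B →+* Ω}
  {n : ℕ}

omit [DecidableEq K] in
lemma exists_algebraMap_eq_of_monic {q : B[X]} (hq : q.Monic) {x : K}
    (hx : (q.map (algebraMap B K)).eval x = 0) : ∃ a : B, algebraMap B K a = x :=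
  IsIntegrallyClosedIn.isIntegral_iff.mp ⟨q, hq, by rwa [← eval_map]⟩

/-- The coordinates of a torsion point of order invertible in `B` are integral over `B`. -/
theorem exists_integral_coordinates (hn : IsUnit (n : B)) {x y : K}
    {h : (W.map (algebraMap B K)).toAffine.Nonsingular x y} (hP : n • Point.some x y h = 0) :
    ∃ a b : B, algebraMap B K a = x ∧ algebraMap B K b = y := by
  obtain ⟨u, hu⟩ := hn
  rw [smul_some_eq_zero_iff, map_ΨSq] at hP
  obtain ⟨a, rfl⟩ : ∃ a : B, algebraMap B K a = x := by
    -- The leading coefficient of `ΨSq n` is n², a unit in B.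
    refine exists_algebraMap_eq_of_monic (q := C ((u⁻¹ ^ 2 : Bˣ) : B) * W.ΨSq n) ?_ ?_
    · refine monic_of_natDegree_le_of_coeff_eq_one (n ^ 2 - 1) ?_ ?_
      · refine natDegree_C_mul_le _ _ |>.trans ?_
        simpa using W.natDegree_ΨSq_le n
      · have := W.coeff_ΨSq n
        rw [Int.natAbs_natCast] at this
        rw [coeff_C_mul, this, Int.cast_natCast, ← hu]
        rw [← Units.val_pow_eq_pow_val, ← Units.val_mul, inv_pow, inv_mul_cancel, Units.val_one]
    · rw [Polynomial.map_mul, eval_mul, hP, mul_zero]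
  obtain ⟨b, rfl⟩ : ∃ b : B, algebraMap B K b = y := by
    refine exists_algebraMap_eq_of_monic
      (q := X ^ 2 + (C (W.a₁ * a + W.a₃) * X +
        C (-(a ^ 3 + W.a₂ * a ^ 2 + W.a₄ * a + W.a₆)))) ?_ ?_
    · nontriviality B
      refine monic_X_pow_add (degree_linear_le.trans_lt ?_)
      norm_num
    · have := (equation_iff ..).mp h.1
      simp only [map_a₁, map_a₂, map_a₃, map_a₄, map_a₆] at this
      simp only [Polynomial.map_add, Polynomial.map_mul, Polynomial.map_pow, map_X, map_C,
        Polynomial.map_neg, eval_neg, eval_add, eval_mul, eval_pow, eval_X, eval_C, map_add,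
        map_mul, map_pow, map_neg]
      linear_combination this
  exact ⟨a, b, rfl, rfl⟩

omit [DecidableEq K] in
lemma equation_of_algebraMap {a b : B} (h : (W.map (algebraMap B K)).toAffine.Equation
    (algebraMap B K a) (algebraMap B K b)) : W.toAffine.Equation a b :=
  (W.toAffine.map_equation (IsIntegralClosure.algebraMap_injective B B K) a b).mp h

/-- Reduction is injective on torsion of order invertible in `B`. -/
theorem eq_of_map_eq [(W.map θ).IsElliptic] (hn : IsUnit (n : B)) {a b a' b' : B}
    {h : (W.map (algebraMap B K)).toAffine.Nonsingular (algebraMap B K a) (algebraMap B K b)}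
    {h' : (W.map (algebraMap B K)).toAffine.Nonsingular (algebraMap B K a') (algebraMap B K b')}
    (hP : n • Point.some _ _ h = 0) (hP' : n • Point.some _ _ h' = 0)
    (ha : θ a = θ a') (hb : θ b = θ b') : a = a' ∧ b = b' := by
  have hinj := IsIntegralClosure.algebraMap_injective B B K
  have hθ : (W.map θ).toAffine.Nonsingular (θ a) (θ b) :=
    equation_iff_nonsingular.mp ((equation_of_algebraMap h.1).map θ)
  -- The homogeneous coordinates of the x-coordinate of the doubled reduced point cannot both
  -- vanish, the reduced curve being smooth.
  have hcontra : ¬ ((W.map θ).psiTwoSq (θ a) = 0 ∧ (W.map θ).addSubProd (θ a) (θ a) = 0) := by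
    rintro ⟨h₁, h₂⟩
    obtain ⟨c, hc, e₀, e₁⟩ := exists_addSubMap_self hθ
    rw [h₁, eq_comm, mul_eq_zero_iff_left hc] at e₁
    rw [h₂, eq_comm, mul_eq_zero_iff_left hc] at e₀
    refine (Point.some _ _ hθ + Point.some _ _ hθ).xRep_ne_zero (funext fun i ↦ ?_)
    fin_cases i
    exacts [e₀, e₁]
  -- If the x-coordinates differ, P ± Q are nonzero torsion points and so have integral coordinates.
  -- The sum and product formulas, whose left sides contain (a - a')², reduce to the vanishing
  -- excluded by `hcontra`.
  have haa : a = a' := by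
    by_contra hne
    obtain ⟨x, y, hxy, x', y', hxy', hadd, hsub, hs, hp⟩ :=
      exists_add_sub_of_X_ne h h' (hinj.ne hne)
    obtain ⟨c, -, rfl, -⟩ := exists_integral_coordinates hn
      (show n • Point.some x y hxy = 0 by rw [← hadd, smul_add, hP, hP', add_zero])
    obtain ⟨c', -, rfl, -⟩ := exists_integral_coordinates hn
      (show n • Point.some x' y' hxy' = 0 by rw [← hsub, smul_sub, hP, hP', sub_zero])
    rw [map_addSubSum, ← map_sub, ← map_add, ← map_pow, ← map_mul] at hs
    rw [map_addSubProd, ← map_sub, ← map_pow, ← map_mul, ← map_mul] at hp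
    have hs := congrArg θ (hinj hs)
    have hp := congrArg θ (hinj hp)
    rw [map_mul, map_pow, map_sub, ha, sub_self, zero_pow two_ne_zero, mul_zero,
      ← map_addSubSum, ha, addSubSum_self] at hs
    rw [map_mul, map_pow, map_sub, ha, sub_self, zero_pow two_ne_zero, mul_zero,
      ← map_addSubProd, ha] at hp
    rw [ha] at hcontra
    exact hcontra ⟨hs.symm, hp.symm⟩
  subst haa
  refine ⟨rfl, ?_⟩
  by_contra hne
  -- In the remaining case Q = -P ≠ P reduces to the same point as P, so the reduction is 2-torsion;
  -- integrality of x(2P) again contradicts `hcontra`.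
  rcases Y_eq_of_X_eq h.1 h'.1 rfl with e | e
  · exact hne (hinj e)
  rw [negY, map_a₁, map_a₃, ← map_mul, ← map_neg, ← map_sub, ← map_sub] at e
  have e := hinj e
  have hψ : W.psiTwo a b ≠ 0 := by
    rw [psiTwo]
    intro h₀
    apply hne
    linear_combination h₀ - e
  obtain ⟨x, y, hxy, hadd, hx⟩ := exists_add_self h (by
    rw [map_psiTwo]
    exact (map_ne_zero_iff _ hinj).mpr hψ)
  obtain ⟨c, -, rfl, -⟩ := exists_integral_coordinates hn
    (show n • Point.some x y hxy = 0 by rw [← hadd, smul_add, hP, add_zero])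
  rw [map_psiTwoSq, map_addSubProd, ← map_mul] at hx
  have hx := congrArg θ (hinj hx)
  have hzero : (W.map θ).psiTwoSq (θ a) = 0 := by
    rw [← psiTwo_sq _ hθ.1, map_psiTwo, sq_eq_zero_iff]
    have := congrArg θ e
    simp only [map_sub, map_neg, map_mul] at this
    simp only [psiTwo, map_add, map_mul, map_ofNat]
    linear_combination this + hb
  rw [map_mul, ← map_psiTwoSq, hzero, mul_zero, ← map_addSubProd] at hx
  exact hcontra ⟨hzero, hx.symm⟩

end Reduction

end WeierstrassCurve

/-! ### Finite abelian groups with an involution -/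

section Involution

lemma card_ker_mul_card_range {G H : Type*} [AddCommGroup G] [AddCommGroup H] (f : G →+ H) :
    Nat.card f.ker * Nat.card f.range = Nat.card G := by
  rw [← AddSubgroup.index_ker, AddSubgroup.card_mul_index]

/-- Both {0, a} and {0, b} have index M, so M • x lies in their intersection. -/
lemma nsmul_eq_zero_of_two_torsion {K : Type*} [AddCommGroup K] {M : ℕ}
    (hK : Nat.card K = 2 * M) {a b : K} (ha : a ≠ 0) (hb : b ≠ 0) (hab : a ≠ b)
    (ha2 : 2 • a = 0) (hb2 : 2 • b = 0) (x : K) : M • x = 0 := by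
  have key : ∀ c : K, c ≠ 0 → 2 • c = 0 → M • x = 0 ∨ M • x = c := by
    intro c hc hc2
    have hcard : Nat.card (AddSubgroup.zmultiples c) = 2 := by
      rw [Nat.card_zmultiples, addOrderOf_eq_prime hc2 hc]
    have hidx : (AddSubgroup.zmultiples c).index = M := by
      have := (AddSubgroup.zmultiples c).card_mul_index
      rw [hcard, hK] at this
      omega
    have hmem := (AddSubgroup.zmultiples c).nsmul_index_mem x
    rw [hidx, AddSubgroup.mem_zmultiples_iff] at hmem
    obtain ⟨i, e⟩ := hmem
    have hc2 : (2 : ℤ) • c = 0 := by exact_mod_cast hc2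
    rcases Int.even_or_odd' i with ⟨j, rfl | rfl⟩
    · exact Or.inl (by rw [← e, mul_comm, mul_smul, hc2, smul_zero])
    · exact Or.inr (by rw [← e, add_smul, mul_comm, mul_smul, hc2, smul_zero, zero_add, one_smul])
  rcases key a ha ha2 with h | h
  · exact h
  · rcases key b hb hb2 with h' | h'
    · exact h'
    · exact absurd (h.symm.trans h') hab

lemma exists_two_torsion {K : Type*} [AddCommGroup K] [Finite K] {M : ℕ}
    (hK : Nat.card K = 2 * M) : ∃ x : K, x ≠ 0 ∧ 2 • x = 0 := by
  obtain ⟨x, hx⟩ := exists_prime_addOrderOf_dvd_card' 2 (hK ▸ dvd_mul_right 2 M)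
  refine ⟨x, fun h ↦ ?_, hx ▸ addOrderOf_nsmul_eq_zero x⟩
  simp [h] at hx

lemma card_range_two {K : Type*} [AddCommGroup K] [Finite K] {M : ℕ}
    (hK : Nat.card K = 2 * M) {t : K} (ht : ∀ x : K, 2 • x = 0 → x = 0 ∨ x = t) :
    Nat.card (nsmulAddMonoidHom (α := K) 2).range = M := by
  have hker : Nat.card (nsmulAddMonoidHom (α := K) 2).ker = 2 := by
    obtain ⟨x, hx, hx2⟩ := exists_two_torsion hK
    have e : ((nsmulAddMonoidHom (α := K) 2).ker : Set K) = {0, x} := by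
      ext y
      simp only [SetLike.mem_coe, AddMonoidHom.mem_ker, nsmulAddMonoidHom_apply,
        Set.mem_insert_iff, Set.mem_singleton_iff]
      constructor
      · intro hy
        rcases ht y hy with rfl | rfl
        · exact Or.inl rfl
        · exact Or.inr ((ht x hx2).resolve_left hx).symm
      · rintro (rfl | rfl)
        exacts [smul_zero _, hx2]
    rw [← SetLike.coe_sort_coe, Nat.card_coe_set_eq, e, Set.ncard_pair hx.symm]
  have := card_ker_mul_card_range (nsmulAddMonoidHom (α := K) 2)
  rw [hker, hK] at this
  omega

/-- The 2-part of K is cyclic. For even M one descends to 2K, of order M; for odd M the element of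
order 2 is not killed by M. -/
lemma exists_nsmul_ne_zero_of_two_torsion {K : Type*} [AddCommGroup K] [Finite K] {M : ℕ}
    (hK : Nat.card K = 2 * M) {t : K} (ht : ∀ x : K, 2 • x = 0 → x = 0 ∨ x = t) :
    ∃ x : K, M • x ≠ 0 := by
  induction M using Nat.strong_induction_on generalizing K with
  | _ M ih =>
    rcases Nat.even_or_odd' M with ⟨m, rfl | rfl⟩
    · have hr := card_range_two hK ht
      have hm : 0 < m := by
        have := Nat.card_pos (α := K)
        omega
      obtain ⟨⟨_, y, rfl⟩, hx⟩ := ih m (by omega) hr (t := ⟨t, by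
        obtain ⟨⟨x, hx⟩, hx₀, hx₂⟩ := exists_two_torsion hr
        rcases ht x (congrArg Subtype.val hx₂) with rfl | rfl
        · exact absurd rfl hx₀
        · exact hx⟩) (by
        rintro ⟨x, hx⟩ hx₂
        simpa using ht x (congrArg Subtype.val hx₂))
      refine ⟨y, fun h ↦ hx (Subtype.ext ?_)⟩
      rw [mul_comm, mul_smul] at h
      exact h
    · obtain ⟨x, hx, hx2⟩ := exists_two_torsion hK
      refine ⟨x, ?_⟩
      rwa [add_smul, mul_comm, mul_smul, hx2, smul_zero, zero_add, one_smul]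

/-- 2K has index 2 and is killed by M, whereas K is not; so the elements killed by M are exactly
those of 2K. -/
lemma exists_eq_two_nsmul {K : Type*} [AddCommGroup K] [Finite K] {M : ℕ}
    (hK : Nat.card K = 2 * M) {t : K} (ht : ∀ x : K, 2 • x = 0 → x = 0 ∨ x = t) {x : K}
    (hx : M • x = 0) : ∃ y, x = 2 • y := by
  obtain ⟨z, hz⟩ := exists_nsmul_ne_zero_of_two_torsion hK ht
  have hr := card_range_two hK ht
  have hidx : (nsmulAddMonoidHom (α := K) 2).range.index = 2 := by
    have := (nsmulAddMonoidHom (α := K) 2).range.card_mul_index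
    rw [hr, hK, mul_comm] at this
    refine Nat.eq_of_mul_eq_mul_right ?_ this
    have := Nat.card_pos (α := K)
    omega
  have hkill : ∀ y ∈ (nsmulAddMonoidHom (α := K) 2).range, M • y = 0 := by
    rintro _ ⟨y, rfl⟩
    rw [nsmulAddMonoidHom_apply, ← mul_smul, mul_comm, ← hK]
    exact card_nsmul_eq_zero'
  by_contra! hne
  have hx' : x ∉ (nsmulAddMonoidHom (α := K) 2).range := by
    rintro ⟨y, hy⟩
    exact hne y hy.symm
  have hz' : z ∉ (nsmulAddMonoidHom (α := K) 2).range := fun h ↦ hz (hkill z h)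
  have := hkill _ ((AddSubgroup.add_mem_iff_of_index_two hidx).mpr (iff_of_false hz' hx'))
  rw [smul_add, hx, add_zero] at this
  exact hz this

/-- Let `φ` be an involution of an abelian group `G` of order `N ^ 2`, with `N` even. If both
eigengroups of `φ` have order `N`, then `N` kills `G`. -/
theorem nsmul_eq_zero_of_involution {G : Type*} [AddCommGroup G] [Finite G] (φ : G →+ G)
    (hφ : ∀ x, φ (φ x) = x) {N : ℕ} (hN : Even N) (hN₀ : 0 < N) (hG : Nat.card G = N ^ 2)
    (h₁ : Nat.card (φ - AddMonoidHom.id G).ker = N)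
    (h₂ : Nat.card (φ + AddMonoidHom.id G).ker = N) (x : G) : N • x = 0 := by
  obtain ⟨M, rfl⟩ := hN.two_dvd
  set Kp := (φ - AddMonoidHom.id G).ker with hKp
  set Km := (φ + AddMonoidHom.id G).ker with hKm
  have mem_p : ∀ x, x ∈ Kp ↔ φ x = x := fun x ↦ by
    simp [hKp, AddMonoidHom.mem_ker, sub_eq_zero]
  have mem_m : ∀ x, x ∈ Km ↔ φ x = -x := fun x ↦ by
    simp [hKm, AddMonoidHom.mem_ker, add_eq_zero_iff_eq_neg]
  have hs : ∀ x, x + φ x ∈ Kp := fun x ↦ by rw [mem_p, map_add, hφ, add_comm]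
  have hd : ∀ x, x - φ x ∈ Km := fun x ↦ by rw [mem_m, map_sub, hφ, neg_sub]
  have hMp : ∀ x ∈ Kp, (2 * M) • x = 0 := fun x hx ↦ by
    have := card_nsmul_eq_zero' (x := (⟨x, hx⟩ : Kp))
    rw [h₁] at this
    exact congrArg Subtype.val this
  have hMm : ∀ x ∈ Km, (2 * M) • x = 0 := fun x hx ↦ by
    have := card_nsmul_eq_zero' (x := (⟨x, hx⟩ : Km))
    rw [h₂] at this
    exact congrArg Subtype.val this
  have hneg : ∀ x : G, 2 • x = 0 → -x = x := fun x hx ↦ by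
    rw [two_nsmul] at hx; exact neg_eq_of_add_eq_zero_left hx
  have hpm : ∀ x : G, 2 • x = 0 → (x ∈ Kp ↔ x ∈ Km) := fun x hx ↦ by
    rw [mem_p, mem_m, hneg x hx]
  -- The two terms lie in the eigengroups, which have order 2M, so each is killed by 2. The
  -- eigengroups have the same 2-torsion, on which signs do not matter.
  have hsplit : (2 * M) • x = M • (x + φ x) + M • (x - φ x) := by
    rw [← smul_add, add_add_sub_cancel, ← two_nsmul, ← mul_smul, mul_comm]
  obtain ⟨⟨t, htp⟩, ht₀, ht₂⟩ := exists_two_torsion h₁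
  replace ht₂ : 2 • t = 0 := congrArg Subtype.val ht₂
  replace ht₀ : t ≠ 0 := fun h ↦ ht₀ (Subtype.ext h)
  have htm := (hpm t ht₂).mp htp
  by_cases hT : ∃ u ∈ Kp, 2 • u = 0 ∧ u ≠ 0 ∧ u ≠ t
  · obtain ⟨u, hup, hu₂, hu₀, hut⟩ := hT
    have hum := (hpm u hu₂).mp hup
    have e₁ := nsmul_eq_zero_of_two_torsion h₁ (a := ⟨u, hup⟩) (b := ⟨t, htp⟩)
      (fun h ↦ hu₀ (congrArg Subtype.val h)) (fun h ↦ ht₀ (congrArg Subtype.val h))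
      (fun h ↦ hut (congrArg Subtype.val h)) (Subtype.ext hu₂) (Subtype.ext ht₂) ⟨_, hs x⟩
    have e₂ := nsmul_eq_zero_of_two_torsion h₂ (a := ⟨u, hum⟩) (b := ⟨t, htm⟩)
      (fun h ↦ hu₀ (congrArg Subtype.val h)) (fun h ↦ ht₀ (congrArg Subtype.val h))
      (fun h ↦ hut (congrArg Subtype.val h)) (Subtype.ext hu₂) (Subtype.ext ht₂) ⟨_, hd x⟩
    rw [hsplit, show M • (x + φ x) = 0 from congrArg Subtype.val e₁,
      show M • (x - φ x) = 0 from congrArg Subtype.val e₂, add_zero]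
  -- Now t is the only element of order 2 in either eigengroup, and it is enough that the two terms
  -- of `hsplit` vanish together, since 2t = 0.
  push Not at hT
  have hTp : ∀ u ∈ Kp, 2 • u = 0 → u = 0 ∨ u = t := fun u hu hu₂ ↦ by
    by_cases h : u = 0
    exacts [Or.inl h, Or.inr (hT u hu hu₂ h)]
  have hTm : ∀ u ∈ Km, 2 • u = 0 → u = 0 ∨ u = t := fun u hu hu₂ ↦ hTp u ((hpm u hu₂).mpr hu) hu₂
  -- By counting: the image of φ + 1 has order N² / N, the order of the eigengroup containing it.
  have hsurj_s : ∀ k ∈ Kp, ∃ y, y + φ y = k := by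
    have hle : (φ + AddMonoidHom.id G).range ≤ Kp := by
      rintro _ ⟨y, rfl⟩
      simpa [add_comm] using hs y
    have hc := card_ker_mul_card_range (φ + AddMonoidHom.id G)
    rw [h₂, hG, sq] at hc
    have := AddSubgroup.eq_of_le_of_card_ge hle (by
      rw [h₁, Nat.eq_of_mul_eq_mul_left hN₀ hc])
    intro k hk
    rw [← this] at hk
    obtain ⟨y, hy⟩ := hk
    exact ⟨y, by simpa [add_comm] using hy⟩
  have hsurj_d : ∀ k ∈ Km, ∃ y, y - φ y = k := by
    have hle : (φ - AddMonoidHom.id G).range ≤ Km := by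
      rintro _ ⟨y, rfl⟩
      simpa using Km.neg_mem (hd y)
    have hc := card_ker_mul_card_range (φ - AddMonoidHom.id G)
    rw [h₁, hG, sq] at hc
    have := AddSubgroup.eq_of_le_of_card_ge hle (by
      rw [h₂, Nat.eq_of_mul_eq_mul_left hN₀ hc])
    intro k hk
    rw [← this] at hk
    obtain ⟨y, hy⟩ := hk
    exact ⟨-y, by rw [map_neg, ← hy]; simp [sub_eq_add_neg, add_comm]⟩
  -- By cyclicity and `hsurj_s`, x + φ x = 2(y + φ y). Then x - 2y and y - φ y both lie in the
  -- (-1)-eigengroup, which is killed by 2M, and M(x - φ x) is 2M times their sum.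
  have h_sd : M • (x + φ x) = 0 → M • (x - φ x) = 0 := by
    intro h
    obtain ⟨⟨a, ha⟩, e⟩ := exists_eq_two_nsmul h₁ (t := ⟨t, htp⟩)
      (fun u hu ↦ (hTp u u.2 (congrArg Subtype.val hu)).imp
        (fun h ↦ Subtype.ext h) (fun h ↦ Subtype.ext h)) (x := ⟨_, hs x⟩)
      (Subtype.ext h)
    replace e : x + φ x = 2 • a := congrArg Subtype.val e
    obtain ⟨y, rfl⟩ := hsurj_s a ha
    have hz : x - 2 • y ∈ Km := by
      rw [mem_m, map_sub, map_nsmul, neg_sub, sub_eq_sub_iff_add_eq_add, add_comm, e, smul_add]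
    have e₁ := hMm _ hz
    have e₂ := hMm _ (hd y)
    have e₃ : M • (x - φ x) = (2 * M) • (x - 2 • y) + (2 * M) • (y - φ y) := by
      have : φ x = 2 • (y + φ y) - x := by rw [← e, add_sub_cancel_left]
      rw [this]
      module
    rw [e₃, e₁, e₂, add_zero]
  have h_ds : M • (x - φ x) = 0 → M • (x + φ x) = 0 := by
    intro h
    obtain ⟨⟨a, ha⟩, e⟩ := exists_eq_two_nsmul h₂ (t := ⟨t, htm⟩)
      (fun u hu ↦ (hTm u u.2 (congrArg Subtype.val hu)).imp
        (fun h ↦ Subtype.ext h) (fun h ↦ Subtype.ext h)) (x := ⟨_, hd x⟩)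
      (Subtype.ext h)
    replace e : x - φ x = 2 • a := congrArg Subtype.val e
    obtain ⟨y, rfl⟩ := hsurj_d a ha
    have hz : x - 2 • y ∈ Kp := by
      have : φ x = x - 2 • (y - φ y) := by rw [← e, sub_sub_cancel]
      rw [mem_p, map_sub, map_nsmul, this]
      module
    have e₁ := hMp _ hz
    have e₂ := hMp _ (hs y)
    have e₃ : M • (x + φ x) = (2 * M) • (x - 2 • y) + (2 * M) • (y + φ y) := by
      have : φ x = x - 2 • (y - φ y) := by rw [← e, sub_sub_cancel]
      rw [this]
      module
    rw [e₃, e₁, e₂, add_zero]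
  have hs2 : 2 • M • (x + φ x) = 0 := by rw [← mul_smul]; exact hMp _ (hs x)
  have hd2 : 2 • M • (x - φ x) = 0 := by rw [← mul_smul]; exact hMm _ (hd x)
  rw [hsplit]
  rcases hTp _ (Kp.nsmul_mem (hs x) M) hs2 with e | e
  · rw [e, h_sd e, add_zero]
  · rcases hTm _ (Km.nsmul_mem (hd x) M) hd2 with e' | e'
    · rw [e', h_ds e', add_zero]
    · rw [e, e', ← two_nsmul, ht₂]

/-- Let `φ` be an endomorphism of an `N`-divisible abelian group all of whose elements are fixed
by some power of `φ`, and such that powers of `φ` have finitely many fixed points. If `φ` has `N`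
fixed points, then `φ - 1` is surjective. -/
theorem exists_sub_eq_of_divisible {A : Type*} [AddCommGroup A] (φ : A →+ A) {N : ℕ}
    (hfin : ∀ n, 0 < n → {x | φ^[n] x = x}.Finite) (hper : ∀ x, ∃ n, 0 < n ∧ φ^[n] x = x)
    (hdiv : ∀ b : A, ∃ c, N • c = b) (hN : {x | φ x = x}.ncard = N) (b : A) :
    ∃ c, φ c - c = b := by
  obtain ⟨c, rfl⟩ := hdiv b
  obtain ⟨n, hn, hc⟩ := hper c
  have hmap : ∀ x y, φ^[n] (x + y) = φ^[n] x + φ^[n] y := fun x y ↦ by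
    simp [← AddMonoid.End.coe_pow φ n]
  have hneg : ∀ x, φ^[n] (-x) = -φ^[n] x := fun x ↦ by
    simp [← AddMonoid.End.coe_pow φ n]
  let H : AddSubgroup A :=
    { carrier := {x | φ^[n] x = x}
      add_mem' := fun {x y} hx hy ↦ by
        simp only [Set.mem_ofPred_eq] at *
        rw [hmap, hx, hy]
      zero_mem' := by simp [← AddMonoid.End.coe_pow φ n]
      neg_mem' := fun {x} hx ↦ by
        simp only [Set.mem_ofPred_eq] at *
        rw [hneg, hx] }
  have hH : ∀ x, x ∈ H ↔ φ^[n] x = x := fun x ↦ Iff.rfl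
  have : Finite H := hfin n hn
  have hφH : ∀ x ∈ H, φ x ∈ H := fun x hx ↦ by
    rw [hH] at *
    rw [← Function.iterate_succ_apply, Function.iterate_succ_apply', hx]
  let ψ : H →+ H := (φ.comp H.subtype).codRestrict H (fun x ↦ hφH x x.2) - AddMonoidHom.id H
  have hψ : ∀ x : H, ((ψ x : H) : A) = φ x - x := fun x ↦ rfl
  have hker : Nat.card ψ.ker = N := by
    rw [← hN, ← Nat.card_coe_set_eq]
    refine Nat.card_congr ⟨fun x ↦ ⟨x.1, ?_⟩, fun x ↦ ⟨⟨x.1, ?_⟩, ?_⟩, fun _ ↦ rfl, fun _ ↦ rfl⟩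
    · have := congrArg Subtype.val (AddMonoidHom.mem_ker.mp x.2)
      rw [hψ] at this
      exact sub_eq_zero.mp this
    · exact Function.iterate_fixed x.2 n
    · rw [AddMonoidHom.mem_ker]
      refine Subtype.ext ?_
      rw [hψ]
      exact sub_eq_zero.mpr x.2
  -- On the finite group H, which contains c, the cokernel of φ - 1 has the order N of its kernel;
  -- hence N • c is in the image.
  have hidx : ψ.range.index = N := by
    have e₁ := card_ker_mul_card_range ψ
    have e₂ := ψ.range.card_mul_index
    rw [← e₁, hker, mul_comm] at e₂
    exact Nat.eq_of_mul_eq_mul_right Nat.card_pos e₂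
  have := ψ.range.nsmul_index_mem ⟨c, hc⟩
  rw [hidx] at this
  obtain ⟨y, hy⟩ := this
  exact ⟨y, by rw [← hψ, hy]; rfl⟩

/-- In the situation of `exists_sub_eq_of_divisible`, if `N` is even, `φ = -1` has `N` solutions
and there are at most `N ^ 2` elements killed by `N`, then `φ ^ 2 = 1` on these elements. -/
theorem apply_apply_eq_of_nsmul_eq_zero {A : Type*} [AddCommGroup A] (φ : A →+ A) {N : ℕ}
    (hfin : ∀ n, 0 < n → {x | φ^[n] x = x}.Finite) (hper : ∀ x, ∃ n, 0 < n ∧ φ^[n] x = x)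
    (hdiv : ∀ b : A, ∃ c, N • c = b) (hN : {x | φ x = x}.ncard = N)
    (hN' : {x | φ x = -x}.ncard = N) (hEven : Even N) (hpos : 0 < N)
    (htors : {x : A | N • x = 0}.Finite) (hcard : {x : A | N • x = 0}.ncard ≤ N ^ 2)
    {x : A} (hx : N • x = 0) : φ (φ x) = x := by
  let G : AddSubgroup A := (φ.comp φ - AddMonoidHom.id A).ker
  have hG : ∀ x, x ∈ G ↔ φ (φ x) = x := fun x ↦ by
    simp [G, AddMonoidHom.mem_ker, sub_eq_zero]
  have hGfin : (G : Set A).Finite := by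
    refine (hfin 2 two_pos).subset fun x hx ↦ ?_
    exact (hG x).mp hx
  have : Finite G := hGfin
  let ψ : G →+ G := (φ.comp G.subtype).codRestrict G fun x ↦ by
    rw [hG]
    exact congrArg φ ((hG x).mp x.2)
  have hψ : ∀ x : G, ((ψ x : G) : A) = φ x := fun x ↦ rfl
  have h₁ : Nat.card (ψ - AddMonoidHom.id G).ker = N := by
    rw [← hN, ← Nat.card_coe_set_eq]
    refine Nat.card_congr ⟨fun x ↦ ⟨x.1, ?_⟩, fun x ↦ ⟨⟨x.1, ?_⟩, ?_⟩, fun _ ↦ rfl, fun _ ↦ rfl⟩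
    · exact sub_eq_zero.mp (congrArg Subtype.val (AddMonoidHom.mem_ker.mp x.2))
    · rw [hG, show φ x.1 = x.1 from x.2, show φ x.1 = x.1 from x.2]
    · rw [AddMonoidHom.mem_ker]
      exact Subtype.ext (sub_eq_zero.mpr x.2)
  have h₂ : Nat.card (ψ + AddMonoidHom.id G).ker = N := by
    rw [← hN', ← Nat.card_coe_set_eq]
    refine Nat.card_congr ⟨fun x ↦ ⟨x.1, ?_⟩, fun x ↦ ⟨⟨x.1, ?_⟩, ?_⟩, fun _ ↦ rfl, fun _ ↦ rfl⟩
    · exact add_eq_zero_iff_eq_neg.mp (congrArg Subtype.val (AddMonoidHom.mem_ker.mp x.2))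
    · rw [hG, show φ x.1 = -x.1 from x.2, map_neg, show φ x.1 = -x.1 from x.2, neg_neg]
    · rw [AddMonoidHom.mem_ker]
      exact Subtype.ext (add_eq_zero_iff_eq_neg.mpr x.2)
  -- If φ b = -b and φ c - c = b, then φ(φ c) = c, so the preimage stays in G. This makes the order
  -- of G equal to N · N.
  have hrange : (ψ - AddMonoidHom.id G).range = (ψ + AddMonoidHom.id G).ker := by
    ext b
    constructor
    · rintro ⟨y, rfl⟩
      rw [AddMonoidHom.mem_ker]
      refine Subtype.ext ?_
      have := (hG y).mp y.2
      simp [hψ, this]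
    · intro hb
      have hb' : φ b = -b := add_eq_zero_iff_eq_neg.mp (congrArg Subtype.val
        (AddMonoidHom.mem_ker.mp hb))
      obtain ⟨c, hc⟩ := exists_sub_eq_of_divisible φ hfin hper hdiv hN b
      refine ⟨⟨c, ?_⟩, Subtype.ext hc⟩
      have e : φ c = c + b := by rw [← hc, add_sub_cancel]
      rw [hG, e, map_add, e, hb', add_neg_cancel_right]
  have hcardG : Nat.card G = N ^ 2 := by
    rw [← card_ker_mul_card_range (ψ - AddMonoidHom.id G), hrange, h₁, h₂, sq]
  have hkill := nsmul_eq_zero_of_involution ψ (fun x ↦ Subtype.ext ((hG x).mp x.2)) hEven hpos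
    hcardG h₁ h₂
  have hsub : (G : Set A) ⊆ {x : A | N • x = 0} := fun x hx ↦
    congrArg Subtype.val (hkill ⟨x, hx⟩)
  have heq := Set.eq_of_subset_of_ncard_le hsub (by
    rw [← Nat.card_coe_set_eq (G : Set A)]
    exact hcard.trans hcardG.ge) htors
  rw [← hG, ← SetLike.mem_coe, heq]
  exact hx

end Involution

/-! ### Points of elliptic curves over finite fields -/

section FiniteField

open Polynomial

/-- With m = (p - 1)/2, X^p - X divides f^m - ε, with quotient u of degree 3m - p. Differentiating
and eliminating f^m shows that X^p - X divides f u + m ε f′. This has degree 3 + deg u = m + 2, so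
it is nonzero, and m + 2 < p because p > 3. -/
lemma FiniteField.exists_eval_pow_ne {k : Type*} [Field k] [Fintype k] {p : ℕ}
    (hp : 3 < p) (hpp : p.Prime) (hcard : Fintype.card k = p) {f : k[X]} (hf : f.natDegree = 3)
    {ε : k} (hε : ∀ x, f.eval x ^ (p / 2) = ε) : False := by
  classical
  obtain ⟨m, hm⟩ : ∃ m, p = 2 * m + 1 := hpp.odd_of_ne_two (by omega)
  have hm2 : p / 2 = m := by omega
  rw [hm2] at hε
  have : Fact p.Prime := ⟨hpp⟩
  have : CharP k p := by
    have := CharP.exists k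
    obtain ⟨q, hq⟩ := this
    obtain ⟨n, hq', hn⟩ := FiniteField.card k q
    rw [hcard] at hn
    have : q = p :=
      ((Nat.prime_dvd_prime_iff_eq hpp hq').1 (hpp.dvd_of_dvd_pow (dvd_of_eq hn))).symm
    exact this ▸ hq
  have hdvd : (X ^ p - X : k[X]) ∣ f ^ m - C ε := by
    have h1 : (X ^ p - X : k[X]) = (Finset.univ.val.map fun a => X - C a).prod := by
      have hsplit := FiniteField.isSplittingField_sub k k
      rw [← FiniteField.roots_X_pow_card_sub_X k, hcard]
      refine (Polynomial.prod_multiset_X_sub_C_of_monic_of_roots_card_eq ?_ ?_).symm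
      · exact monic_X_pow_sub (by simpa using hpp.one_lt)
      · rw [← hcard, FiniteField.roots_X_pow_card_sub_X k,
          FiniteField.X_pow_card_sub_X_natDegree_eq _ (by omega)]
        rfl
    rw [h1]
    refine Finset.prod_dvd_of_coprime (fun a _ b _ hab =>
      pairwise_coprime_X_sub_C Function.injective_id hab) fun a _ => ?_
    rw [dvd_iff_isRoot, IsRoot.def, eval_sub, eval_pow, hε, eval_C, sub_self]
  obtain ⟨u, hu⟩ := hdvd
  have hdeg : (f ^ m - C ε).natDegree = 3 * m := by
    rw [natDegree_sub_C, natDegree_pow, hf]; ring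
  have hu0 : u ≠ 0 := by
    rintro rfl
    rw [mul_zero] at hu
    rw [hu] at hdeg
    simp at hdeg
    omega
  have hf0 : f ≠ 0 := by rintro rfl; simp at hf
  have hh0 : (X ^ p - X : k[X]) ≠ 0 := FiniteField.X_pow_card_sub_X_ne_zero k (by omega)
  have hudeg : u.natDegree + p = 3 * m := by
    rw [← hdeg, hu, natDegree_mul hh0 hu0, FiniteField.X_pow_card_sub_X_natDegree_eq k (by omega)]
    ring
  have hder : (m : k[X]) * f ^ (m - 1) * derivative f =
      -u + (X ^ p - X) * derivative u := by
    have := congrArg derivative hu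
    simpa [derivative_pow, derivative_mul] using this
  have hfm : f * f ^ (m - 1) = (X ^ p - X) * u + C ε := by
    rw [← pow_succ', Nat.sub_add_cancel (by omega), ← hu]; ring
  have key : (X ^ p - X : k[X]) * (m * u * derivative f - f * derivative u) =
      -(f * u) - m * C ε * derivative f := by
    linear_combination f * hder - m * derivative f * hfm
  have hfd : (derivative f).natDegree ≤ 2 := by
    have := natDegree_derivative_le f; omega
  have hfu : (f * u).natDegree = 3 + u.natDegree := by rw [natDegree_mul hf0 hu0, hf]
  have hsmall : (m * C ε * derivative f : k[X]).natDegree ≤ 2 := by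
    have : (m * C ε : k[X]) = C (m * ε) := by simp
    rw [this]
    exact (natDegree_C_mul_le _ _).trans hfd
  have hR : (-(f * u) - m * C ε * derivative f : k[X]).natDegree = 3 + u.natDegree := by
    rw [natDegree_sub_eq_left_of_natDegree_lt, natDegree_neg, hfu]
    rw [natDegree_neg, hfu]; omega
  by_cases h0 : (m * u * derivative f - f * derivative u : k[X]) = 0
  · rw [h0, mul_zero] at key
    rw [← key] at hR
    simp at hR
    omega
  · have := congrArg natDegree key
    rw [hR, natDegree_mul hh0 h0, FiniteField.X_pow_card_sub_X_natDegree_eq k (by omega)] at this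
    omega

/-- By Euler's criterion t² = c forces t^q = χ(c) t, so for c ≠ 0 both square roots count if χ(c) =
ε and neither otherwise. -/
lemma FiniteField.ncard_sq_eq {k L : Type*} [Field k] [Fintype k] [DecidableEq k] [Field L]
    [Algebra k L] (h2 : ringChar k ≠ 2) {ε : ℤ} (hε : ε = 1 ∨ ε = -1) (c : k)
    (hsq : quadraticChar k c = ε → IsSquare (algebraMap k L c)) :
    {t : L | t ^ 2 = algebraMap k L c ∧ t ^ Fintype.card k = ε * t}.Finite ∧
    ({t : L | t ^ 2 = algebraMap k L c ∧ t ^ Fintype.card k = ε * t}.ncard : ℤ) =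
      1 + ε * quadraticChar k c := by
  have h2k : (2 : k) ≠ 0 := Ring.two_ne_zero h2
  have h2L : (2 : L) ≠ 0 := by
    rw [← map_ofNat (algebraMap k L)]
    exact (_root_.map_ne_zero _).2 h2k
  have hodd : Fintype.card k = 2 * (Fintype.card k / 2) + 1 := by
    have := FiniteField.odd_card_of_char_ne_two h2
    omega
  have hpow : ∀ t : L, t ^ 2 = algebraMap k L c →
      t ^ Fintype.card k = ((quadraticChar k c : ℤ) : L) * t := by
    intro t ht
    conv_lhs => rw [hodd]
    rw [pow_succ, pow_mul, ht, ← map_pow, ← quadraticChar_eq_pow_of_char_ne_two' h2, map_intCast]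
  by_cases hc : c = 0
  · subst hc
    have : {t : L | t ^ 2 = algebraMap k L 0 ∧ t ^ Fintype.card k = ε * t} = {0} := by
      ext t
      simp only [map_zero, Set.mem_ofPred_eq, Set.mem_singleton_iff, ne_eq, OfNat.ofNat_ne_zero,
        not_false_eq_true, pow_eq_zero_iff, and_iff_left_iff_imp]
      rintro rfl
      simp
    rw [this]
    simp
  by_cases hχ : quadraticChar k c = ε
  · obtain ⟨s, hs⟩ := hsq hχ
    have hs0 : s ≠ 0 := by
      rintro rfl
      simp [hc] at hs
    have : {t : L | t ^ 2 = algebraMap k L c ∧ t ^ Fintype.card k = ε * t} = {s, -s} := by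
      ext t
      simp only [Set.mem_ofPred_eq, Set.mem_insert_iff, Set.mem_singleton_iff]
      constructor
      · rintro ⟨h, -⟩
        rw [hs, ← pow_two] at h
        exact sq_eq_sq_iff_eq_or_eq_neg.1 h
      · intro h
        have h' : t ^ 2 = algebraMap k L c := by
          rw [hs, ← pow_two]
          exact sq_eq_sq_iff_eq_or_eq_neg.2 h
        exact ⟨h', by rw [hpow t h', hχ]⟩
    rw [this, Set.ncard_pair, hχ]
    · refine ⟨by simp, ?_⟩
      rcases hε with rfl | rfl <;> norm_num
    · intro h
      have : 2 * s = 0 := by linear_combination h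
      simp [h2L, hs0] at this
  · have hχ' : quadraticChar k c = -ε := by
      rcases quadraticChar_dichotomy hc with h | h <;> rcases hε with rfl | rfl <;>
        rw [h] at hχ ⊢ <;> simp at hχ ⊢
    have : {t : L | t ^ 2 = algebraMap k L c ∧ t ^ Fintype.card k = ε * t} = ∅ := by
      ext t
      simp only [Set.mem_ofPred_eq, Set.mem_empty_iff_false, iff_false, not_and]
      intro h h'
      rw [hpow t h, hχ'] at h'
      push_cast at h'
      have h0 : (ε : L) * t = 0 := by
        have : 2 * ((ε : L) * t) = 0 := by linear_combination -h'
        simpa [h2L] using this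
      have ht : t = 0 := by
        rcases hε with rfl | rfl <;> simpa using h0
      rw [ht] at h
      simp [eq_comm (a := (0 : L)), hc] at h
    rw [this, hχ']
    refine ⟨by simp, ?_⟩
    rcases hε with rfl | rfl <;> norm_num

end FiniteField

/-! ### Point counts by the quadratic character. -/

namespace WeierstrassCurve

section FiniteField

variable {k L : Type*} [Field k] [Fintype k] [DecidableEq k] [Field L] [Algebra k L]
  (W : WeierstrassCurve k) [W.IsElliptic]

lemma equation_iff_psiTwo_sq {F : Type*} [Field F] (W : WeierstrassCurve F) (h2 : (2 : F) ≠ 0)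
    (x y : F) : W.toAffine.Equation x y ↔ W.psiTwo x y ^ 2 = W.psiTwoSq x := by
  refine ⟨W.psiTwo_sq, fun h => ?_⟩
  rw [Affine.equation_iff]
  have h4 : (4 : F) ≠ 0 := by
    have : (4 : F) = 2 * 2 := by norm_num
    rw [this]; exact mul_ne_zero h2 h2
  apply mul_left_cancel₀ h4
  simp only [psiTwo, psiTwoSq, b₂, b₄, b₆] at h
  linear_combination h

/-- The coordinate ψ₂ completes the square: ψ₂² = `psiTwoSq x`. With L = k and ε = 1 all rational
points are counted; over an algebraically closed L the two signs count the solutions of φP = P and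
of φP = -P. -/
lemma ncard_points (h2 : ringChar k ≠ 2) {ε : ℤ} (hε : ε = 1 ∨ ε = -1)
    (hsq : ∀ c, quadraticChar k c = ε → IsSquare (algebraMap k L c))
    (S : Set (W.map (algebraMap k L)).toAffine.Point) (h0 : 0 ∈ S)
    (hS : ∀ x y h, Affine.Point.some x y h ∈ S ↔ (∃ a, algebraMap k L a = x) ∧
      (W.map (algebraMap k L)).psiTwo x y ^ Fintype.card k =
        ε * (W.map (algebraMap k L)).psiTwo x y) :
    S.Finite ∧ (S.ncard : ℤ) = 1 + Fintype.card k + ε * ∑ x, quadraticChar k (W.psiTwoSq x) := by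
  have h2k : (2 : k) ≠ 0 := Ring.two_ne_zero h2
  have h2L : (2 : L) ≠ 0 := by
    rw [← map_ofNat (algebraMap k L)]
    exact (_root_.map_ne_zero _).2 h2k
  let WL := W.map (algebraMap k L)
  let T : k → Set L := fun a => {y | WL.toAffine.Equation (algebraMap k L a) y ∧
    WL.psiTwo (algebraMap k L a) y ^ Fintype.card k = ε * WL.psiTwo (algebraMap k L a) y}
  have hinj : ∀ x : L, Function.Injective (WL.psiTwo x) := by
    intro x y y' h
    simp only [psiTwo] at h
    exact mul_left_cancel₀ h2L (by linear_combination h)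
  have himage : ∀ a, WL.psiTwo (algebraMap k L a) '' T a =
      {t : L | t ^ 2 = algebraMap k L (W.psiTwoSq a) ∧ t ^ Fintype.card k = ε * t} := by
    intro a
    ext t
    simp only [Set.mem_image, T, Set.mem_ofPred_eq]
    constructor
    · rintro ⟨y, ⟨hy, hy'⟩, rfl⟩
      exact ⟨by rw [WL.psiTwo_sq hy, map_psiTwoSq], hy'⟩
    · rintro ⟨ht, ht'⟩
      obtain ⟨y, rfl⟩ : ∃ y, WL.psiTwo (algebraMap k L a) y = t :=
        ⟨(t - WL.a₁ * algebraMap k L a - WL.a₃) / 2, by simp only [psiTwo]; field_simp; ring⟩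
      refine ⟨y, ⟨?_, ht'⟩, rfl⟩
      rw [equation_iff_psiTwo_sq _ h2L, ht, map_psiTwoSq]
  have hfin : ∀ a, (T a).Finite := fun a =>
    Set.Finite.of_finite_image (by
      rw [himage]; exact (FiniteField.ncard_sq_eq h2 hε _ (hsq _)).1) (hinj _).injOn
  have hcard : ∀ a, ((T a).ncard : ℤ) = 1 + ε * quadraticChar k (W.psiTwoSq a) := fun a => by
    rw [← Set.ncard_image_of_injective _ (hinj (algebraMap k L a)), himage]
    exact (FiniteField.ncard_sq_eq h2 hε _ (hsq _)).2
  have : ∀ a, Finite (T a) := fun a => (hfin a).to_subtype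
  let g : Option (Σ a, T a) → WL.toAffine.Point := fun o => o.elim 0 fun z =>
    Affine.Point.some _ _ (Affine.equation_iff_nonsingular.1 z.2.2.1)
  have hg : Function.Injective g := by
    rintro (_ | ⟨a, y, hy⟩) (_ | ⟨a', y', hy'⟩) h
    · rfl
    · simp [g] at h
    · simp [g] at h
    · simp only [g, Option.elim_some, Affine.Point.some.injEq] at h
      obtain ⟨h1, h2⟩ := h
      obtain rfl := (algebraMap k L).injective h1
      obtain rfl := h2
      rfl
  have hrange : Set.range g = S := by
    ext P
    constructor
    · rintro ⟨_ | ⟨a, y, hy⟩, rfl⟩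
      · exact h0
      · exact (hS _ _ _).2 ⟨⟨a, rfl⟩, hy.2⟩
    · intro hP
      rcases P with _ | ⟨x, y, h⟩
      · exact ⟨none, rfl⟩
      · obtain ⟨⟨a, rfl⟩, hy⟩ := (hS _ _ _).1 hP
        exact ⟨some ⟨a, y, h.1, hy⟩, rfl⟩
  rw [← hrange]
  refine ⟨Set.finite_range _, ?_⟩
  rw [← Nat.card_coe_set_eq, Nat.card_range_of_injective hg, Finite.card_option, Nat.card_sigma]
  push_cast
  simp only [Nat.card_coe_set_eq, hcard, Finset.sum_add_distrib, Finset.mul_sum]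
  simp
  ring

end FiniteField

end WeierstrassCurve

/-! ### The Frobenius endomorphism of a supersingular curve -/

section FiniteField

lemma FiniteField.pow_card_eq_self_iff (k : Type*) {L : Type*} [Field k] [Fintype k] [Field L]
    [Algebra k L] (x : L) : x ^ Fintype.card k = x ↔ ∃ a, algebraMap k L a = x := by
  classical
  constructor
  · intro h
    have h0 : (Polynomial.X ^ Fintype.card k - Polynomial.X : Polynomial L) ≠ 0 :=
      FiniteField.X_pow_card_sub_X_ne_zero L Fintype.one_lt_card
    have hsub : Finset.univ.image (algebraMap k L) ⊆
        (Polynomial.X ^ Fintype.card k - Polynomial.X : Polynomial L).roots.toFinset := by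
      intro y hy
      obtain ⟨a, -, rfl⟩ := Finset.mem_image.1 hy
      rw [Multiset.mem_toFinset, Polynomial.mem_roots h0]
      simp [← map_pow, FiniteField.pow_card]
    have heq := Finset.eq_of_subset_of_card_le hsub (by
      rw [Finset.card_image_of_injective _ (algebraMap k L).injective, Finset.card_univ]
      refine (Multiset.toFinset_card_le _).trans ((Polynomial.card_roots' _).trans ?_)
      rw [FiniteField.X_pow_card_sub_X_natDegree_eq L Fintype.one_lt_card])
    have hx : x ∈ Finset.univ.image (algebraMap k L) := by
      rw [heq, Multiset.mem_toFinset, Polynomial.mem_roots h0]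
      simp [h]
    simpa using hx
  · rintro ⟨a, rfl⟩
    rw [← map_pow, FiniteField.pow_card]

lemma FiniteField.finite_setOf_pow_eq (L : Type*) [Field L] {q : ℕ} (hq : 1 < q) :
    {x : L | x ^ q = x}.Finite := by
  have h0 : (Polynomial.X ^ q - Polynomial.X : Polynomial L) ≠ 0 :=
    FiniteField.X_pow_card_sub_X_ne_zero L hq
  refine (Polynomial.finite_setOfPred_isRoot h0).subset fun x hx => ?_
  simpa [sub_eq_zero] using hx

lemma FiniteField.exists_pow_card_pow_eq (k : Type*) {L : Type*} [Field k] [Fintype k] [Field L]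
    [Algebra k L] [Algebra.IsAlgebraic k L] (x y : L) :
    ∃ n, 0 < n ∧ x ^ Fintype.card k ^ n = x ∧ y ^ Fintype.card k ^ n = y := by
  let M := IntermediateField.adjoin k {x, y}
  have : FiniteDimensional k M := IntermediateField.finiteDimensional_adjoin fun z _ =>
    (Algebra.IsAlgebraic.isAlgebraic z).isIntegral
  have : Finite M := Module.finite_of_finite k
  have : Fintype M := Fintype.ofFinite M
  have hM : ∀ z ∈ M, z ^ Fintype.card k ^ Module.finrank k M = z := by
    intro z hz
    have := FiniteField.pow_card (⟨z, hz⟩ : M)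
    rw [Module.card_eq_pow_finrank (K := k) (V := M)] at this
    exact congrArg Subtype.val this
  exact ⟨_, Module.finrank_pos, hM x (IntermediateField.subset_adjoin _ _ (by simp)),
    hM y (IntermediateField.subset_adjoin _ _ (by simp))⟩

end FiniteField

namespace WeierstrassCurve

open WeierstrassCurve.Affine

variable {k Ω : Type*} [Field k] [Fintype k] [Field Ω] [Algebra k Ω]
  (W : WeierstrassCurve k)

/-- The sum has p terms of absolute value at most 1, so divisibility by p leaves 0 and ±p. In the
cases ±p all characters are equal, which `FiniteField.exists_eval_pow_ne` excludes for the cubic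
Ψ₂². The Hasse bound is not needed. -/
lemma sum_quadraticChar_eq_zero [DecidableEq k] [W.IsElliptic] {p : ℕ} (hpp : p.Prime) (hp : 3 < p)
    (hcard : Fintype.card k = p) (htr : (p : ℤ) ∣ frobeniusTrace W) :
    ∑ x, quadraticChar k (W.psiTwoSq x) = 0 := by
  have h2 : ringChar k ≠ 2 := by
    intro h
    have := FiniteField.even_card_iff_char_two.1 h
    rw [hcard] at this
    have := hpp.eq_two_or_odd
    omega
  have hpoints := (ncard_points (L := k) W h2 (ε := 1) (Or.inl rfl) (by
    intro c hc
    have hc0 : c ≠ 0 := by rintro rfl; simp at hc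
    exact (quadraticChar_one_iff_isSquare hc0).1 hc) Set.univ trivial (by
      intro x y h
      refine ⟨fun _ => ⟨⟨x, rfl⟩, ?_⟩, fun _ => trivial⟩
      rw [FiniteField.pow_card, Int.cast_one, one_mul])).2
  rw [Set.ncard_univ, show W.map (algebraMap k k) = W from W.map_id] at hpoints
  have htr' : frobeniusTrace W = -∑ x, quadraticChar k (W.psiTwoSq x) := by
    rw [frobeniusTrace, hpoints, Nat.card_eq_fintype_card]
    ring
  rw [htr', dvd_neg] at htr
  obtain ⟨c, hc⟩ := htr
  have hle : ∀ x, |quadraticChar k (W.psiTwoSq x)| ≤ 1 := fun x => by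
    rcases quadraticChar_isQuadratic k (W.psiTwoSq x) with h | h | h <;> simp [h]
  have hbound : |∑ x, quadraticChar k (W.psiTwoSq x)| ≤ p := by
    refine (Finset.abs_sum_le_sum_abs _ _).trans ((Finset.sum_le_sum fun x _ => hle x).trans ?_)
    simp [hcard]
  have hp0 : (0 : ℤ) < p := by omega
  have hc1 : |c| ≤ 1 := by
    rw [hc, abs_mul, abs_of_pos hp0] at hbound
    exact le_of_mul_le_mul_left (by simpa using hbound) hp0
  have hf : W.Ψ₂Sq.natDegree = 3 := by
    refine W.natDegree_Ψ₂Sq ?_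
    have h2k : (2 : k) ≠ 0 := Ring.two_ne_zero h2
    have h4 : (4 : k) = 2 * 2 := by norm_num
    rw [h4]; exact mul_ne_zero h2k h2k
  have hextreme : ∀ ε : ℤ, (ε = 1 ∨ ε = -1) → c ≠ ε := by
    rintro ε hε rfl
    have hall : ∀ x, quadraticChar k (W.psiTwoSq x) = c := by
      have hsum : ∑ x : k, (1 - c * quadraticChar k (W.psiTwoSq x)) = 0 := by
        rw [Finset.sum_sub_distrib, ← Finset.mul_sum, hc]
        simp only [Finset.sum_const, Finset.card_univ, hcard]
        rcases hε with rfl | rfl <;> simp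
      have hnonneg : ∀ x ∈ Finset.univ, 0 ≤ 1 - c * quadraticChar k (W.psiTwoSq x) := by
        intro x _
        have := abs_le.1 (hle x)
        rcases hε with rfl | rfl <;> linarith
      intro x
      have := (Finset.sum_eq_zero_iff_of_nonneg hnonneg).1 hsum x (Finset.mem_univ x)
      rcases hε with rfl | rfl <;> linarith
    refine FiniteField.exists_eval_pow_ne hp hpp hcard hf (ε := c) fun x => ?_
    rw [eval_Ψ₂Sq, ← hcard, ← quadraticChar_eq_pow_of_char_ne_two' h2, hall]
  have : c = 0 := by
    have h1 := hextreme 1 (Or.inl rfl)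
    have h2 := hextreme (-1) (Or.inr rfl)
    have := abs_le.1 hc1
    omega
  rw [hc, this, mul_zero]

variable [DecidableEq Ω]

variable (Ω) in
/-- The Frobenius endomorphism of the group of points over an extension of a finite field. -/
noncomputable def frobeniusPoint :
    (W.baseChange Ω).toAffine.Point →+ (W.baseChange Ω).toAffine.Point :=
  Point.map (W' := W) (FiniteField.frobeniusAlgHom k Ω)

lemma frobeniusPoint_some {x y : Ω} (h : (W.baseChange Ω).toAffine.Nonsingular x y) :
    ∃ h', frobeniusPoint Ω W (.some x y h) =
      .some (x ^ Fintype.card k) (y ^ Fintype.card k) h' :=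
  ⟨_, Point.map_some (W' := W) (FiniteField.frobeniusAlgHom k Ω) h⟩

lemma iterate_frobeniusPoint_some {x y : Ω} (h : (W.baseChange Ω).toAffine.Nonsingular x y)
    (n : ℕ) : ∃ h', (frobeniusPoint Ω W)^[n] (.some x y h) =
      .some (x ^ Fintype.card k ^ n) (y ^ Fintype.card k ^ n) h' := by
  induction n with
  | zero => exact ⟨by simpa using h, by simp⟩
  | succ n ih =>
    obtain ⟨h', e⟩ := ih
    obtain ⟨h'', e'⟩ := frobeniusPoint_some W h'
    simp only [← pow_mul, ← pow_succ] at h'' e'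
    exact ⟨h'', by rw [Function.iterate_succ_apply', e, e']⟩

lemma iterate_frobeniusPoint_eq_self_iff {x y : Ω}
    (h : (W.baseChange Ω).toAffine.Nonsingular x y) (n : ℕ) :
    (frobeniusPoint Ω W)^[n] (.some x y h) = .some x y h ↔
      x ^ Fintype.card k ^ n = x ∧ y ^ Fintype.card k ^ n = y := by
  obtain ⟨h', e⟩ := iterate_frobeniusPoint_some W h n
  rw [e, Point.some.injEq]

lemma finite_setOf_iterate_frobeniusPoint_eq {n : ℕ} (hn : 0 < n) :
    {P | (frobeniusPoint Ω W)^[n] P = P}.Finite := by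
  have hq : 1 < Fintype.card k ^ n := Nat.one_lt_pow hn.ne' Fintype.one_lt_card
  have hfin := FiniteField.finite_setOf_pow_eq Ω hq
  let c : (W.baseChange Ω).toAffine.Point → Option (Ω × Ω) := fun P => match P with
    | 0 => none
    | .some x y _ => some (x, y)
  have hc : Function.Injective c := by
    rintro (_ | ⟨x, y, h⟩) (_ | ⟨x', y', h'⟩) e
    · rfl
    · cases e
    · cases e
    · cases e; rfl
  refine Set.Finite.of_finite_image (f := c)
    (((hfin.prod hfin).image some).insert none |>.subset ?_)
    hc.injOn
  rintro _ ⟨_ | ⟨x, y, h⟩, hP, rfl⟩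
  · exact Set.mem_insert _ _
  · exact Set.mem_insert_of_mem _ ⟨(x, y), (iterate_frobeniusPoint_eq_self_iff W h n).1 hP, rfl⟩

lemma exists_iterate_frobeniusPoint_eq [Algebra.IsAlgebraic k Ω]
    (P : (W.baseChange Ω).toAffine.Point) : ∃ n, 0 < n ∧ (frobeniusPoint Ω W)^[n] P = P := by
  rcases P with _ | ⟨x, y, h⟩
  · exact ⟨1, one_pos, map_zero (frobeniusPoint Ω W)⟩
  · obtain ⟨n, hn, hx, hy⟩ := FiniteField.exists_pow_card_pow_eq k x y
    exact ⟨n, hn, (iterate_frobeniusPoint_eq_self_iff W h n).2 ⟨hx, hy⟩⟩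

/-- Negation fixes x and changes the sign of ψ₂; this puts φP = ±P in the form counted by
`ncard_points`. -/
lemma frobeniusPoint_eq_zsmul_iff (h2 : (2 : Ω) ≠ 0) {x y : Ω}
    (h : (W.baseChange Ω).toAffine.Nonsingular x y) {ε : ℤ} (hε : ε = 1 ∨ ε = -1) :
    frobeniusPoint Ω W (.some x y h) = ε • Point.some x y h ↔
      (∃ a, algebraMap k Ω a = x) ∧
      (W.baseChange Ω).psiTwo x y ^ Fintype.card k = ε * (W.baseChange Ω).psiTwo x y := by
  obtain ⟨h', e⟩ := frobeniusPoint_some W h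
  rw [e, ← FiniteField.pow_card_eq_self_iff]
  have hpow : ∀ z : Ω, z ^ Fintype.card k = FiniteField.frobeniusAlgHom k Ω z := fun _ => rfl
  have hpsi : (W.baseChange Ω).psiTwo x y ^ Fintype.card k =
      2 * y ^ Fintype.card k + algebraMap k Ω W.a₁ * x ^ Fintype.card k + algebraMap k Ω W.a₃ := by
    simp only [psiTwo, hpow, map_add, map_mul, map_ofNat]
    simp [baseChange]
  have ha₁ : (W.baseChange Ω).a₁ = algebraMap k Ω W.a₁ := rfl
  have ha₃ : (W.baseChange Ω).a₃ = algebraMap k Ω W.a₃ := rfl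
  rcases hε with rfl | rfl
  · rw [one_smul, Point.some.injEq, hpsi]
    refine and_congr_right fun hx => ⟨fun hy => ?_, fun hy => ?_⟩
    · rw [hx, hy, psiTwo, ha₁, ha₃]; push_cast; ring
    · rw [hx, psiTwo, ha₁, ha₃] at hy
      push_cast at hy
      exact mul_left_cancel₀ h2 (by linear_combination hy)
  · rw [neg_smul, one_smul, Point.neg_some, Point.some.injEq, hpsi, negY]
    refine and_congr_right fun hx => ⟨fun hy => ?_, fun hy => ?_⟩
    · rw [hx, hy, psiTwo, ha₁, ha₃]; push_cast; ring
    · rw [hx, psiTwo, ha₁, ha₃] at hy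
      push_cast at hy
      rw [ha₁, ha₃]
      exact mul_left_cancel₀ h2 (by linear_combination hy)

/-- Over a prime field with `p > 3` elements, if `p` divides the trace of Frobenius, then the
square of Frobenius fixes the `(p + 1)`-torsion. -/
theorem pow_sq_eq_self_of_smul_eq_zero [IsAlgClosed Ω] [Algebra.IsAlgebraic k Ω] [W.IsElliptic]
    {p : ℕ} (hpp : p.Prime) (hp : 3 < p) (hcard : Fintype.card k = p)
    (htr : (p : ℤ) ∣ frobeniusTrace W) {x y : Ω}
    (h : (W.baseChange Ω).toAffine.Nonsingular x y) (hP : (p + 1) • Point.some x y h = 0) :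
    x ^ p ^ 2 = x ∧ y ^ p ^ 2 = y := by
  classical
  have h2 : ringChar k ≠ 2 := by
    intro h
    have := FiniteField.even_card_iff_char_two.1 h
    rw [hcard] at this
    have := hpp.eq_two_or_odd
    omega
  have h2k : (2 : k) ≠ 0 := Ring.two_ne_zero h2
  have h2L : (2 : Ω) ≠ 0 := by
    rw [← map_ofNat (algebraMap k Ω)]
    exact (map_ne_zero _).2 h2k
  have hS := W.sum_quadraticChar_eq_zero hpp hp hcard htr
  -- The character sum vanishes, so both signs give p + 1 points.
  have hcount : ∀ ε : ℤ, (ε = 1 ∨ ε = -1) →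
      {P | frobeniusPoint Ω W P = ε • P}.ncard = p + 1 := by
    intro ε hε
    have : ({P | frobeniusPoint Ω W P = ε • P}.ncard : ℤ) = _ := (ncard_points (L := Ω) W h2 hε
      (fun c _ => IsAlgClosed.exists_eq_mul_self _) {P | frobeniusPoint Ω W P = ε • P}
      ((map_zero (frobeniusPoint Ω W)).trans (smul_zero ε).symm)
      (fun x y h => frobeniusPoint_eq_zsmul_iff W h2L h hε)).2
    rw [hS, hcard] at this
    omega
  have hcast : ((p + 1 : ℕ) : Ω) = 1 := by
    have : (p : k) = 0 := by rw [← hcard, FiniteField.cast_card_eq_zero]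
    have := congrArg (algebraMap k Ω) this
    rw [map_natCast, map_zero] at this
    rw [Nat.cast_add, this, zero_add, Nat.cast_one]
  have hEven : Even (p + 1) := (hpp.odd_of_ne_two (by omega)).add_one
  have : (W.baseChange Ω).IsElliptic := inferInstanceAs (W.map (algebraMap k Ω)).IsElliptic
  obtain ⟨htors, hle⟩ := ncard_torsion_le (W := (W.baseChange Ω).toAffine) hEven
    (hcast ▸ one_ne_zero)
  have key := apply_apply_eq_of_nsmul_eq_zero (frobeniusPoint Ω W) (N := p + 1)
    (fun n hn => finite_setOf_iterate_frobeniusPoint_eq W hn)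
    (exists_iterate_frobeniusPoint_eq W) (fun Q => smul_surjective (by omega) Q)
    (by simpa using hcount 1 (Or.inl rfl)) (by simpa using hcount (-1) (Or.inr rfl))
    hEven (by omega) htors hle hP
  have := (iterate_frobeniusPoint_eq_self_iff W h 2).1 key
  rwa [hcard] at this

end WeierstrassCurve

/-! ### Points under a change of variables -/

namespace WeierstrassCurve

open WeierstrassCurve.Affine

section VariableChange

variable {F : Type*} [Field F] (W : WeierstrassCurve F) (C : VariableChange F)

namespace VariableChange

/-- The `x`-coordinate of the image of a point under a change of variables. -/
def mapX (x : F) : F := C.u ^ 2 * x + C.r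

/-- The `y`-coordinate of the image of a point under a change of variables. -/
def mapY (x y : F) : F := C.u ^ 3 * y + C.u ^ 2 * C.s * x + C.t

lemma mapX_injective : Function.Injective C.mapX := fun _ _ h =>
  mul_left_cancel₀ (pow_ne_zero 2 C.u.ne_zero) (add_right_cancel h)

lemma mapY_injective (x : F) : Function.Injective (C.mapY x) := by
  intro y y' h
  simp only [mapY] at h
  exact mul_left_cancel₀ (pow_ne_zero 3 C.u.ne_zero) (by linear_combination h)

lemma mapX_surjective : Function.Surjective C.mapX := fun x =>
  ⟨(x - C.r) / C.u ^ 2, by simp [mapX, mul_div_cancel₀]⟩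

lemma mapY_surjective (x : F) : Function.Surjective (C.mapY x) := fun y =>
  ⟨(y - C.u ^ 2 * C.s * x - C.t) / C.u ^ 3, by
    rw [mapY, mul_div_cancel₀ _ (pow_ne_zero 3 C.u.ne_zero)]; ring⟩

end VariableChange

lemma equation_variableChange_iff (x y : F) :
    (C • W).toAffine.Equation x y ↔ W.toAffine.Equation (C.mapX x) (C.mapY x y) := by
  rw [equation_iff', equation_iff']
  have hu : (C.u : F) ≠ 0 := C.u.ne_zero
  have key : (C.u : F) ^ 6 * (y ^ 2 + (C • W).a₁ * x * y + (C • W).a₃ * y -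
      (x ^ 3 + (C • W).a₂ * x ^ 2 + (C • W).a₄ * x + (C • W).a₆)) =
      C.mapY x y ^ 2 + W.a₁ * C.mapX x * C.mapY x y + W.a₃ * C.mapY x y -
        (C.mapX x ^ 3 + W.a₂ * C.mapX x ^ 2 + W.a₄ * C.mapX x + W.a₆) := by
    simp only [variableChange_def, Units.val_inv_eq_inv_val, VariableChange.mapX,
      VariableChange.mapY]
    field_simp
    ring
  rw [← key]
  simp [hu]

lemma mapY_negY (x y : F) :
    C.mapY x ((C • W).toAffine.negY x y) = W.toAffine.negY (C.mapX x) (C.mapY x y) := by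
  have hu : (C.u : F) ≠ 0 := C.u.ne_zero
  simp only [negY, variableChange_def, Units.val_inv_eq_inv_val, VariableChange.mapX,
      VariableChange.mapY]
  field_simp
  ring

variable [DecidableEq F]

/-- Slopes transform by λ ↦ uλ + s, for chords and tangents alike; this reduces additivity of the
change of variables to polynomial identities. -/
lemma slope_mapX_mapY {x₁ x₂ y₁ y₂ : F} (h₁ : (C • W).toAffine.Equation x₁ y₁)
    (h₂ : (C • W).toAffine.Equation x₂ y₂)
    (hxy : ¬(x₁ = x₂ ∧ y₁ = (C • W).toAffine.negY x₂ y₂)) :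
    W.toAffine.slope (C.mapX x₁) (C.mapX x₂) (C.mapY x₁ y₁) (C.mapY x₂ y₂) =
      C.u * (C • W).toAffine.slope x₁ x₂ y₁ y₂ + C.s := by
  have hu : (C.u : F) ≠ 0 := C.u.ne_zero
  by_cases hx : x₁ = x₂
  · subst hx
    have hy : y₁ ≠ (C • W).toAffine.negY x₁ y₂ := fun h => hxy ⟨rfl, h⟩
    obtain rfl : y₁ = y₂ := Y_eq_of_Y_ne h₁ h₂ rfl hy
    have hy' : C.mapY x₁ y₁ ≠ W.toAffine.negY (C.mapX x₁) (C.mapY x₁ y₁) := by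
      rw [← mapY_negY]
      exact fun h => hy (C.mapY_injective x₁ h)
    rw [slope_of_Y_ne rfl hy', slope_of_Y_ne rfl hy]
    have hd : y₁ - (C • W).toAffine.negY x₁ y₁ ≠ 0 := sub_ne_zero.2 hy
    have hd' : C.mapY x₁ y₁ - W.toAffine.negY (C.mapX x₁) (C.mapY x₁ y₁) =
        C.u ^ 3 * (y₁ - (C • W).toAffine.negY x₁ y₁) := by
      rw [← mapY_negY, VariableChange.mapY, VariableChange.mapY]; ring
    rw [hd', div_eq_iff (mul_ne_zero (pow_ne_zero 3 hu) hd)]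
    have : ((C.u : F) * ((3 * x₁ ^ 2 + 2 * (C • W).a₂ * x₁ + (C • W).a₄ - (C • W).a₁ * y₁) /
        (y₁ - (C • W).toAffine.negY x₁ y₁)) + C.s) *
        (C.u ^ 3 * (y₁ - (C • W).toAffine.negY x₁ y₁)) =
        C.u ^ 4 * (3 * x₁ ^ 2 + 2 * (C • W).a₂ * x₁ + (C • W).a₄ - (C • W).a₁ * y₁) +
        C.s * (C.u ^ 3 * (y₁ - (C • W).toAffine.negY x₁ y₁)) := by
      generalize (y₁ - (C • W).toAffine.negY x₁ y₁) = d at hd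
      field_simp
    refine Eq.trans ?_ this.symm
    simp only [negY, variableChange_def, Units.val_inv_eq_inv_val, VariableChange.mapX,
      VariableChange.mapY]
    field_simp
    ring
  · have hx' : C.mapX x₁ ≠ C.mapX x₂ := fun h => hx (C.mapX_injective h)
    rw [slope_of_X_ne hx', slope_of_X_ne hx, div_eq_iff (sub_ne_zero.2 hx')]
    have hd : x₁ - x₂ ≠ 0 := sub_ne_zero.2 hx
    have hd' : C.mapX x₁ - C.mapX x₂ = C.u ^ 2 * (x₁ - x₂) := by
      rw [VariableChange.mapX, VariableChange.mapX]; ring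
    rw [hd']
    simp only [VariableChange.mapY]
    field_simp
    ring

/-- A change of variables as a homomorphism of the groups of points. -/
noncomputable def variableChangePoint [W.IsElliptic] :
    (C • W).toAffine.Point →+ W.toAffine.Point where
  toFun P := match P with
    | 0 => 0
    | .some x y h => .some (C.mapX x) (C.mapY x y)
        (equation_iff_nonsingular.1 ((equation_variableChange_iff W C x y).1 h.1))
  map_zero' := rfl
  map_add' := by
    rintro (_ | ⟨x₁, y₁, h₁⟩) (_ | ⟨x₂, y₂, h₂⟩)
    any_goals rfl
    by_cases hxy : x₁ = x₂ ∧ y₁ = (C • W).toAffine.negY x₂ y₂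
    · rw [Point.add_of_Y_eq hxy.1 hxy.2, Point.add_of_Y_eq (by rw [hxy.1])
        (by rw [hxy.1, hxy.2, mapY_negY])]
    · have hxy' : ¬(C.mapX x₁ = C.mapX x₂ ∧
          C.mapY x₁ y₁ = W.toAffine.negY (C.mapX x₂) (C.mapY x₂ y₂)) := by
        rintro ⟨hx, hy⟩
        have := C.mapX_injective hx
        subst this
        rw [← mapY_negY] at hy
        exact hxy ⟨rfl, C.mapY_injective _ hy⟩
      have hu : (C.u : F) ≠ 0 := C.u.ne_zero
      have hX : C.mapX ((C • W).toAffine.addX x₁ x₂ ((C • W).toAffine.slope x₁ x₂ y₁ y₂)) =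
          W.toAffine.addX (C.mapX x₁) (C.mapX x₂)
          (C.u * (C • W).toAffine.slope x₁ x₂ y₁ y₂ + C.s) := by
        simp only [addX, variableChange_def, Units.val_inv_eq_inv_val, VariableChange.mapX]
        field_simp
        ring
      rw [Point.add_some hxy, Point.add_some hxy']
      simp only [slope_mapX_mapY W C h₁.1 h₂.1 hxy, Point.some.injEq]
      refine ⟨hX, ?_⟩
      rw [addY, addY, mapY_negY, hX]
      congr 1
      rw [negAddY, negAddY, ← hX]
      simp only [VariableChange.mapX, VariableChange.mapY]
      ring

lemma smul_mapX_mapY_eq_zero_iff [W.IsElliptic] {x y : F}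
    (h : (C • W).toAffine.Nonsingular x y)
    (h' : W.toAffine.Nonsingular (C.mapX x) (C.mapY x y)) (n : ℕ) :
    n • Point.some (C.mapX x) (C.mapY x y) h' = 0 ↔ n • Point.some x y h = 0 := by
  have hinj : ∀ P, variableChangePoint W C P = 0 → P = 0 := by
    rintro (_ | ⟨x, y, h⟩) hP
    · rfl
    · cases hP
  rw [show Point.some (C.mapX x) (C.mapY x y) h' = variableChangePoint W C (.some x y h) from rfl,
    ← map_nsmul]
  exact ⟨hinj _, fun h => by rw [h, map_zero]⟩

end VariableChange

end WeierstrassCurve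

/-! ### Torsion coordinates and Frobenius -/

namespace WeierstrassCurve

open WeierstrassCurve.Affine Polynomial

section TorsionPair

variable {R S : Type*} [CommRing R] [CommRing S]

/-- `(a, b)` solves the equation of `W` and the `n`-th division polynomial. -/
def IsTorsionPair (W : WeierstrassCurve R) (n : ℕ) (a b : R) : Prop :=
  W.toAffine.Equation a b ∧ (W.ΨSq n).eval a = 0

variable {W : WeierstrassCurve R} {n : ℕ} {a b a' b' : R}

lemma IsTorsionPair.map (h : W.IsTorsionPair n a b) (f : R →+* S) :
    (W.map f).IsTorsionPair n (f a) (f b) := by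
  refine ⟨h.1.map f, ?_⟩
  rw [map_ΨSq, eval_map, eval₂_at_apply, h.2, map_zero]

lemma isTorsionPair_map_iff {f : R →+* S} (hf : Function.Injective f) :
    (W.map f).IsTorsionPair n (f a) (f b) ↔ W.IsTorsionPair n a b := by
  refine ⟨fun h => ⟨(W.toAffine.map_equation hf a b).1 h.1, ?_⟩, fun h => h.map f⟩
  have := h.2
  rwa [map_ΨSq, eval_map, eval₂_at_apply, map_eq_zero_iff _ hf] at this

lemma isTorsionPair_iff {F : Type*} [Field F] [DecidableEq F] {W : WeierstrassCurve F}
    [W.IsElliptic] {x y : F} :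
    W.IsTorsionPair n x y ↔ ∃ h : W.toAffine.Nonsingular x y, n • Point.some x y h = 0 := by
  constructor
  · rintro ⟨h₁, h₂⟩
    exact ⟨equation_iff_nonsingular.1 h₁, (smul_some_eq_zero_iff _ _).2 h₂⟩
  · rintro ⟨h₁, h₂⟩
    exact ⟨h₁.1, (smul_some_eq_zero_iff _ _).1 h₂⟩

lemma IsTorsionPair.eq_of_map_eq {K Ω : Type*} [Field K] [Algebra R K] [IsIntegrallyClosedIn R K]
    [Field Ω] {θ : R →+* Ω} [(W.map θ).IsElliptic] [(W.map (algebraMap R K)).IsElliptic]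
    (hn : IsUnit (n : R)) (hP : W.IsTorsionPair n a b) (hP' : W.IsTorsionPair n a' b')
    (ha : θ a = θ a') (hb : θ b = θ b') : a = a' ∧ b = b' := by
  classical
  obtain ⟨_, h⟩ := isTorsionPair_iff.1 (hP.map (algebraMap R K))
  obtain ⟨_, h'⟩ := isTorsionPair_iff.1 (hP'.map (algebraMap R K))
  exact WeierstrassCurve.eq_of_map_eq hn h h' ha hb

end TorsionPair

/-- If `p` divides the trace of Frobenius of the reduction of `W`, then an integral domain whose
automorphisms are detected on the `(p + 1)`-torsion of `W` is reduced into `𝔽_{p²}`, and its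
automorphisms are detected on the reduction. -/
theorem pow_sq_eq_self_and_eq_one_of_map_eq {R B K k Ω : Type*} [CommRing R] [CommRing B]
    [Algebra R B] [Field K] [Algebra B K] [IsIntegrallyClosedIn B K] [Field k] [Fintype k]
    [Field Ω] [Algebra k Ω] [IsAlgClosed Ω] [Algebra.IsAlgebraic k Ω] (W : WeierstrassCurve R)
    {ρ : R →+* k} {θ : B →+* Ω} (hθ : θ.comp (algebraMap R B) = (algebraMap k Ω).comp ρ)
    [(W.map ρ).IsElliptic] [((W.map (algebraMap R B)).map (algebraMap B K)).IsElliptic]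
    {p : ℕ} (hpp : p.Prime) (hp : 3 < p) (hcard : Fintype.card k = p)
    (htr : (p : ℤ) ∣ frobeniusTrace (W.map ρ)) (hn : IsUnit ((p + 1 : ℕ) : B))
    (hgen : ∀ τ : B ≃ₐ[R] B, (∀ a b, (W.map (algebraMap R B)).IsTorsionPair (p + 1) a b →
      τ a = a ∧ τ b = b) → τ = 1)
    (hfrob : ∃ τ : B ≃ₐ[R] B, ∀ b, θ (τ b) = θ b ^ p) :
    (∀ b, θ b ^ p ^ 2 = θ b) ∧ ∀ τ : B ≃ₐ[R] B, (∀ b, θ (τ b) = θ b) → τ = 1 := by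
  classical
  have hW : (W.map (algebraMap R B)).map θ = (W.map ρ).baseChange Ω := by
    rw [baseChange, map_map, map_map, hθ]
  have hell' : ((W.map ρ).baseChange Ω).IsElliptic :=
    inferInstanceAs ((W.map ρ).map (algebraMap k Ω)).IsElliptic
  have hell : ((W.map (algebraMap R B)).map θ).IsElliptic := hW ▸ hell'
  have hτ : ∀ (τ : B ≃ₐ[R] B) {a b : B}, (W.map (algebraMap R B)).IsTorsionPair (p + 1) a b →
      (W.map (algebraMap R B)).IsTorsionPair (p + 1) (τ a) (τ b) := by
    intro τ a b h
    have := h.map (τ : B →+* B)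
    rwa [map_map, show (τ : B →+* B).comp (algebraMap R B) = algebraMap R B from
      τ.toAlgHom.comp_algebraMap] at this
  have hsq : ∀ {a b : B}, (W.map (algebraMap R B)).IsTorsionPair (p + 1) a b →
      θ a ^ p ^ 2 = θ a ∧ θ b ^ p ^ 2 = θ b := by
    intro a b h
    have := h.map θ
    rw [hW] at this
    obtain ⟨_, h'⟩ := isTorsionPair_iff.1 this
    exact (W.map ρ).pow_sq_eq_self_of_smul_eq_zero hpp hp hcard htr _ h'
  -- τ maps torsion pairs to torsion pairs, and these are separated by θ.
  have hfree : ∀ τ : B ≃ₐ[R] B, (∀ a b, (W.map (algebraMap R B)).IsTorsionPair (p + 1) a b →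
      θ (τ a) = θ a ∧ θ (τ b) = θ b) → τ = 1 := by
    refine fun τ h => hgen τ fun a b hab => ?_
    exact (hτ τ hab).eq_of_map_eq (K := K) hn hab (h a b hab).1 (h a b hab).2
  refine ⟨fun b => ?_, fun τ h => hfree τ fun a b _ => ⟨h a, h b⟩⟩
  obtain ⟨τ, hτp⟩ := hfrob
  have hpow : ∀ b, θ (τ (τ b)) = θ b ^ p ^ 2 := fun b => by
    rw [hτp, hτp, ← pow_mul, pow_two]
  -- τ² induces the p²-power map, which is trivial on the reduced torsion. So τ² = 1, and the
  -- p²-power map is trivial on all of θ(B).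
  have h1 : τ * τ = 1 := hfree _ fun a b hab => by
    simpa only [AlgEquiv.mul_apply, hpow] using hsq hab
  rw [← hpow, ← AlgEquiv.mul_apply, h1, AlgEquiv.one_apply]

end WeierstrassCurve

/-! ### Counting automorphisms by the reductions of the conjugates of one element. -/

section Count

/-- If `B` is reduced into the field with `p²` elements, its automorphisms are detected on the
reduction, and ring homomorphisms from `B` to `Ω` are detected on a single element, then there are
at most `p² - p` automorphisms. -/
theorem card_algEquiv_le {R B k Ω : Type*} [CommRing R] [CommRing B] [Algebra R B] [Field k]
    [Fintype k] [Field Ω] [Algebra k Ω] {p : ℕ} (hp : 1 < p) (hcard : Fintype.card k = p)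
    {θ : B →+* Ω} (hsq : ∀ b, θ b ^ p ^ 2 = θ b)
    (hfree : ∀ τ : B ≃ₐ[R] B, (∀ b, θ (τ b) = θ b) → τ = 1) {α : B}
    (hα : ∀ f g : B →+* Ω, f α = g α → f = g) : Nat.card (B ≃ₐ[R] B) ≤ p ^ 2 - p := by
  classical
  have hinj : Function.Injective fun τ : B ≃ₐ[R] B => θ (τ α) := by
    intro σ τ h
    have h' := hα (θ.comp (σ : B →+* B)) (θ.comp (τ : B →+* B)) h
    have : σ * τ⁻¹ = 1 := hfree _ fun b => by
      have := congrArg (fun f : B →+* Ω => f (τ.symm b)) h'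
      change θ (σ (τ.symm b)) = θ b
      simpa using this
    exact mul_inv_eq_one.1 this
  have hle : ∀ s : Set Ω, s.Finite → (∀ τ : B ≃ₐ[R] B, θ (τ α) ∈ s) →
      Nat.card (B ≃ₐ[R] B) ≤ s.ncard := by
    intro s hs h
    rw [← Nat.card_range_of_injective hinj, Nat.card_coe_set_eq]
    exact Set.ncard_le_ncard (by rintro _ ⟨τ, rfl⟩; exact h τ) hs
  have hkcard : (Set.range (algebraMap k Ω)).ncard = p := by
    rw [← Nat.card_coe_set_eq, Nat.card_range_of_injective (algebraMap k Ω).injective,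
      Nat.card_eq_fintype_card, hcard]
  -- If one conjugate of α reduces into 𝔽_p, then θ ∘ τ and its composite with Frobenius agree at α,
  -- hence everywhere, and θ(B) lies in 𝔽_p. Otherwise all values avoid 𝔽_p.
  by_cases hex : ∃ τ : B ≃ₐ[R] B, θ (τ α) ^ p = θ (τ α)
  · obtain ⟨τ, hτ⟩ := hex
    have hfrob := hα (((FiniteField.frobeniusAlgHom k Ω : Ω →ₐ[k] Ω) : Ω →+* Ω).comp
      (θ.comp (τ : B →+* B))) (θ.comp (τ : B →+* B)) (by simpa [hcard] using hτ)
    have hall : ∀ b, θ b ^ p = θ b := fun b => by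
      have := congrArg (fun f : B →+* Ω => f (τ.symm b)) hfrob
      simpa [hcard] using this
    refine (hle (Set.range (algebraMap k Ω)) (Set.finite_range _) fun σ => ?_).trans ?_
    · exact (FiniteField.pow_card_eq_self_iff k _).1 (by rw [hcard, hall])
    · rw [hkcard, pow_two]
      have : p * 2 ≤ p * p := Nat.mul_le_mul_left p hp
      omega
  · push Not at hex
    have hp2 : 1 < p ^ 2 := Nat.one_lt_pow two_ne_zero hp
    have hfin := FiniteField.finite_setOf_pow_eq Ω hp2
    have hcard2 : {x : Ω | x ^ p ^ 2 = x}.ncard ≤ p ^ 2 := by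
      have h0 := FiniteField.X_pow_card_sub_X_ne_zero Ω hp2
      have : {x : Ω | x ^ p ^ 2 = x} ⊆
          ((Polynomial.X ^ p ^ 2 - Polynomial.X : Polynomial Ω).roots.toFinset : Set Ω) := by
        intro x hx
        rw [Finset.mem_coe, Multiset.mem_toFinset, Polynomial.mem_roots h0]
        simpa [sub_eq_zero] using hx
      refine (Set.ncard_le_ncard this (Finset.finite_toSet _)).trans ?_
      rw [Set.ncard_coe_finset]
      refine (Multiset.toFinset_card_le _).trans ((Polynomial.card_roots' _).trans ?_)
      rw [FiniteField.X_pow_card_sub_X_natDegree_eq Ω hp2]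
    have hsub : Set.range (algebraMap k Ω) ⊆ {x : Ω | x ^ p ^ 2 = x} := by
      rintro _ ⟨a, rfl⟩
      have : a ^ p = a := by rw [← hcard, FiniteField.pow_card]
      rw [Set.mem_ofPred_eq, ← map_pow, pow_two, pow_mul, this, this]
    refine (hle ({x : Ω | x ^ p ^ 2 = x} \ Set.range (algebraMap k Ω)) hfin.sdiff fun τ =>
      ⟨hsq _, fun h => hex τ ?_⟩).trans ?_
    · rw [← hcard]; exact (FiniteField.pow_card_eq_self_iff k _).2 h
    · rw [Set.ncard_sdiff hsub (Set.finite_range _), hkcard]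
      omega

end Count

/-! ### The local ring at a prime and its integral closures -/

section Local

variable (p : ℕ) [Fact p.Prime]

lemma isUnit_natCast_pLocalIntegers {m : ℕ} (hm : ¬ p ∣ m) : IsUnit (m : pLocalIntegers p) := by
  have hm0 : (m : ℚ) ≠ 0 := by
    rintro h
    rw [Nat.cast_eq_zero] at h
    exact hm (h ▸ dvd_zero p)
  have hmem : (m : ℚ)⁻¹ ∈ pLocalIntegers p := by
    change Rat.padicValuation p _ ≤ 1
    rw [map_inv₀, ← Int.cast_natCast, Rat.padicValuation_cast, Int.padicValuation_eq_one_iff.2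
      (by exact_mod_cast hm), inv_one]
  exact IsUnit.of_mul_eq_one ⟨_, hmem⟩ (Subtype.ext (by simp [hm0]))

lemma not_dvd_den_of_mem_pLocalIntegers (x : pLocalIntegers p) : ¬ p ∣ (x : ℚ).den :=
  Rat.padicValuation_le_one_iff.1 x.2

lemma natCast_den_mul_pLocalIntegers (x : pLocalIntegers p) :
    ((x : ℚ).den : pLocalIntegers p) * x = ((x : ℚ).num : pLocalIntegers p) := by
  apply Subtype.ext
  push_cast
  exact Rat.den_mul_eq_num _

lemma natCast_mem_maximalIdeal_pLocalIntegers :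
    (p : pLocalIntegers p) ∈ IsLocalRing.maximalIdeal (pLocalIntegers p) := by
  rw [IsLocalRing.mem_maximalIdeal, mem_nonunits_iff, isUnit_iff_exists_inv]
  rintro ⟨y, hy⟩
  have h1 := congrArg (Rat.padicValuation p ∘ Subtype.val) hy
  simp only [Function.comp_apply, MulMemClass.coe_mul, map_mul] at h1
  have hy1 : Rat.padicValuation p (y : ℚ) ≤ 1 := y.2
  have hp1 : Rat.padicValuation p ((p : pLocalIntegers p) : ℚ) < 1 := by
    have : ((p : pLocalIntegers p) : ℚ) = ((p : ℤ) : ℚ) := by push_cast; rfl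
    rw [this, Rat.padicValuation_cast, Int.padicValuation_lt_one_iff]
  have : Rat.padicValuation p ((p : pLocalIntegers p) : ℚ) * Rat.padicValuation p (y : ℚ) < 1 :=
    mul_lt_one_of_lt_of_le hp1 hy1
  rw [h1] at this
  simp at this

lemma charP_residueField_pLocalIntegers :
    CharP (IsLocalRing.ResidueField (pLocalIntegers p)) p := by
  refine (CharP.charP_iff_prime_eq_zero Fact.out).2 ?_
  rw [← map_natCast (IsLocalRing.residue (pLocalIntegers p)), IsLocalRing.residue_eq_zero_iff]
  exact natCast_mem_maximalIdeal_pLocalIntegers p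

lemma card_residueField_pLocalIntegers :
    Nat.card (IsLocalRing.ResidueField (pLocalIntegers p)) = p := by
  have := charP_residueField_pLocalIntegers p
  have hbij : Function.Bijective
      (ZMod.castHom (dvd_refl p) (IsLocalRing.ResidueField (pLocalIntegers p))) := by
    refine ⟨RingHom.injective _, fun y => ?_⟩
    obtain ⟨x, rfl⟩ := IsLocalRing.residue_surjective y
    have h := congrArg (IsLocalRing.residue (pLocalIntegers p)) (natCast_den_mul_pLocalIntegers p x)
    rw [map_mul, map_natCast, map_intCast] at h
    have hne : (((x : ℚ).den : ℕ) : IsLocalRing.ResidueField (pLocalIntegers p)) ≠ 0 := by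
      rw [Ne, CharP.cast_eq_zero_iff _ p]
      exact not_dvd_den_of_mem_pLocalIntegers p x
    refine ⟨((x : ℚ).num : ZMod p) / ((x : ℚ).den : ZMod p), ?_⟩
    rw [map_div₀, map_intCast, map_natCast, div_eq_iff hne, mul_comm]
    exact h.symm
  rw [← Nat.card_congr (Equiv.ofBijective _ hbij), Nat.card_zmod]

/-- The integers prime to `p`. -/
def primeToSubmonoid : Submonoid ℤ where
  carrier := {m | ¬ (p : ℤ) ∣ m}
  one_mem' h := (Fact.out : p.Prime).one_lt.ne'
    (by simpa using Int.eq_one_of_dvd_one (by positivity) h)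
  mul_mem' ha hb h := ((Nat.prime_iff_prime_int.1 Fact.out).dvd_or_dvd h).elim ha hb

/-- With this, an element integral over ℤ_(p) becomes an algebraic integer after multiplication by
an integer prime to p. -/
instance isLocalization_pLocalIntegers :
    IsLocalization (primeToSubmonoid p) (pLocalIntegers p) where
  map_units := by
    rintro ⟨m, hm⟩
    obtain ⟨k, hk⟩ := Int.eq_nat_or_neg m
    have : IsUnit (k : pLocalIntegers p) := isUnit_natCast_pLocalIntegers p fun h => hm (by
      rcases hk with rfl | rfl
      · exact_mod_cast h
      · exact (dvd_neg (α := ℤ)).2 (by exact_mod_cast h))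
    rcases hk with rfl | rfl <;> simpa using this
  surj x := ⟨((x : ℚ).num, ⟨(x : ℚ).den, fun h => not_dvd_den_of_mem_pLocalIntegers p x
      (by exact_mod_cast h)⟩), by
    rw [mul_comm]; simpa using natCast_den_mul_pLocalIntegers p x⟩
  exists_of_eq h := ⟨1, by
    rw [eq_intCast, eq_intCast, Int.cast_inj] at h
    rw [h]⟩

end Local

/-! ### Homomorphisms to Ω and Frobenius elements. -/

section Frobenius

/-- A ring homomorphism from a local ring to an algebraically closed extension of its residue
field extends to integral extensions. -/
lemma exists_ringHom_comp_algebraMap_eq {R B Ω : Type*} [CommRing R] [IsLocalRing R] [CommRing B]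
    [Algebra R B] [Algebra.IsIntegral R B] [FaithfulSMul R B] [Field Ω] [IsAlgClosed Ω]
    {φ : R →+* Ω} (hφ : RingHom.ker φ = IsLocalRing.maximalIdeal R) :
    ∃ θ : B →+* Ω, θ.comp (algebraMap R B) = φ := by
  obtain ⟨Q, hQ, hQ'⟩ :=
    Ideal.exists_maximal_ideal_liesOver_of_isIntegral (S := B) (IsLocalRing.maximalIdeal R)
  let := Ideal.Quotient.field Q
  let := Ideal.Quotient.field (IsLocalRing.maximalIdeal R)
  let : Algebra (R ⧸ IsLocalRing.maximalIdeal R) Ω :=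
    (Ideal.Quotient.lift _ φ fun a ha => by rwa [← hφ] at ha).toAlgebra
  have : Algebra.IsIntegral (R ⧸ IsLocalRing.maximalIdeal R) (B ⧸ Q) := inferInstance
  have : Algebra.IsAlgebraic (R ⧸ IsLocalRing.maximalIdeal R) (B ⧸ Q) := inferInstance
  let f : (B ⧸ Q) →ₐ[R ⧸ IsLocalRing.maximalIdeal R] Ω := IsAlgClosed.lift
  refine ⟨(f : (B ⧸ Q) →+* Ω).comp (Ideal.Quotient.mk Q), ?_⟩
  ext r
  have h1 : Ideal.Quotient.mk Q (algebraMap R B r) =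
      algebraMap (R ⧸ IsLocalRing.maximalIdeal R) (B ⧸ Q)
        (Ideal.Quotient.mk (IsLocalRing.maximalIdeal R) r) := rfl
  have h2 := f.commutes (Ideal.Quotient.mk (IsLocalRing.maximalIdeal R) r)
  rw [← h1] at h2
  exact h2

/-- Existence of Frobenius elements, in terms of a homomorphism to a field. -/
lemma exists_map_eq_pow {R B Ω : Type*} [CommRing R] [IsLocalRing R] [CommRing B] [Algebra R B]
    [Module.Finite R B] [Finite (B ≃ₐ[R] B)] [Algebra.IsInvariant R B (B ≃ₐ[R] B)]
    [Finite (IsLocalRing.ResidueField R)] [Field Ω] {θ : B →+* Ω}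
    (hθ : RingHom.ker (θ.comp (algebraMap R B)) = IsLocalRing.maximalIdeal R) :
    ∃ τ : B ≃ₐ[R] B, ∀ b, θ (τ b) = θ b ^ Nat.card (IsLocalRing.ResidueField R) := by
  have hunder : (RingHom.ker θ).under R = IsLocalRing.maximalIdeal R := by
    rw [← hθ, RingHom.ker_eq_comap_bot, RingHom.ker_eq_comap_bot, ← Ideal.comap_comap]
  have : (RingHom.ker θ).IsPrime := RingHom.ker_isPrime θ
  have : (RingHom.ker θ).LiesOver (IsLocalRing.maximalIdeal R) := ⟨hunder.symm⟩
  have : Finite (R ⧸ IsLocalRing.maximalIdeal R) :=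
    inferInstanceAs (Finite (IsLocalRing.ResidueField R))
  have : Module.Finite (R ⧸ IsLocalRing.maximalIdeal R) (B ⧸ RingHom.ker θ) :=
    Module.Finite.of_restrictScalars_finite R _ _
  have : Finite (B ⧸ RingHom.ker θ) := Module.finite_of_finite (R ⧸ IsLocalRing.maximalIdeal R)
  obtain ⟨τ, hτ⟩ := IsArithFrobAt.exists_of_isInvariant R (B ≃ₐ[R] B) (RingHom.ker θ)
  refine ⟨τ, fun b => ?_⟩
  have := hτ b
  rw [RingHom.mem_ker, map_sub, map_pow, sub_eq_zero, hunder] at this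
  exact this

end Frobenius

/-! ### Division fields of supersingular curves -/

namespace WeierstrassCurve

open WeierstrassCurve.Affine

section VariableChange

variable {F : Type*} [Field F] (W : WeierstrassCurve F) [W.IsElliptic] (C : VariableChange F)

lemma isTorsionPair_mapX_mapY_iff {n : ℕ} {x y : F} :
    W.IsTorsionPair n (C.mapX x) (C.mapY x y) ↔ (C • W).IsTorsionPair n x y := by
  classical
  rw [isTorsionPair_iff, isTorsionPair_iff]
  constructor
  · rintro ⟨h', hP⟩
    exact ⟨equation_iff_nonsingular.1 ((equation_variableChange_iff W C x y).2 h'.1),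
      (smul_mapX_mapY_eq_zero_iff W C _ h' n).1 hP⟩
  · rintro ⟨h, hP⟩
    exact ⟨equation_iff_nonsingular.1 ((equation_variableChange_iff W C x y).1 h.1),
      (smul_mapX_mapY_eq_zero_iff W C h _ n).2 hP⟩

end VariableChange

end WeierstrassCurve

open WeierstrassCurve

/-- If the index of `ℤ[α]` in the ring of integers of `K` is prime to `p`, then a homomorphism from
the integral closure of `ℤ_(p)` in `K` to a field of characteristic `p` is determined by its value
at `α`. -/
lemma ringHom_eq_of_not_dvd_index {p : ℕ} [Fact p.Prime] {K : Type*} [Field K] [Algebra ℚ K]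
    {Ω : Type*} [Field Ω] [CharP Ω p] {α : NumberField.RingOfIntegers K}
    (hα : ¬ p ∣ (Subalgebra.toSubmodule (Algebra.adjoin ℤ {α})).toAddSubgroup.index)
    {i : NumberField.RingOfIntegers K →+* integralClosure (pLocalIntegers p) K}
    (hi : ∀ x, (i x : K) = x) {f g : integralClosure (pLocalIntegers p) K →+* Ω}
    (hfg : f (i α) = g (i α)) : f = g := by
  have hadj : ∀ x ∈ Algebra.adjoin ℤ {α}, f (i x) = g (i x) := by
    have : Algebra.adjoin ℤ {α} ≤
        AlgHom.equalizer (f.comp i).toIntAlgHom (g.comp i).toIntAlgHom :=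
      Algebra.adjoin_le (by simpa using hfg)
    exact fun x hx => this hx
  ext b
  obtain ⟨⟨m, hm⟩, hint⟩ :=
    IsIntegral.exists_multiple_integral_of_isLocalization (primeToSubmonoid p) (b : K) b.2
  obtain ⟨c, hc⟩ : ∃ c : NumberField.RingOfIntegers K, (c : K) = m • (b : K) := ⟨⟨_, hint⟩, rfl⟩
  have hc' : i c = m • b := Subtype.ext (by rw [hi, hc]; simp)
  -- The index times m • b lies in ℤ[α], and both factors are invertible in Ω. An infinite index is
  -- recorded as 0, which `hα` excludes.
  have hmem := hadj _ (AddSubgroup.nsmul_index_mem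
    (Subalgebra.toSubmodule (Algebra.adjoin ℤ {α})).toAddSubgroup c)
  rw [map_nsmul, map_nsmul, map_nsmul, hc', map_zsmul, map_zsmul] at hmem
  simp only [nsmul_eq_mul, zsmul_eq_mul] at hmem
  refine mul_left_cancel₀ ?_ (mul_left_cancel₀ ?_ hmem)
  · rw [Ne, CharP.intCast_eq_zero_iff Ω p]; exact hm
  · rw [Ne, CharP.cast_eq_zero_iff Ω p]; exact hα

/-- A Galois number field whose automorphisms are detected on the `(p + 1)`-torsion of an elliptic
curve with supersingular reduction at `p > 3`, and in which `p` does not divide the index of some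
`ℤ[α]`, has degree at most `p² - p`. -/
theorem finrank_le_of_hasGoodSupersingularReduction {E : WeierstrassCurve ℚ} [E.IsElliptic] {p : ℕ}
    [Fact p.Prime] (hp : 3 < p) (hE : HasGoodSupersingularReduction E p) {K : Type*} [Field K]
    [Algebra ℚ K] [FiniteDimensional ℚ K] [IsGalois ℚ K]
    (hgen : ∀ σ : Gal(K/ℚ), (∀ x y, (E.map (algebraMap ℚ K)).IsTorsionPair (p + 1) x y →
      σ x = x ∧ σ y = y) → σ = 1) {α : NumberField.RingOfIntegers K}
    (hα : ¬ p ∣ (Subalgebra.toSubmodule (Algebra.adjoin ℤ {α})).toAddSubgroup.index) :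
    Module.finrank ℚ K ≤ p ^ 2 - p := by
  classical
  have hpp : p.Prime := Fact.out
  let R := pLocalIntegers p
  let B := integralClosure R K
  let k := IsLocalRing.ResidueField R
  let Ω := AlgebraicClosure k
  obtain ⟨C, hC⟩ : ∃ C : VariableChange ℚ, E.minimal R = C • E := ⟨_, rfl⟩
  obtain ⟨hgood, htr⟩ := hE
  let W : WeierstrassCurve R := (E.minimal R).integralModel R
  have hW : W.map (algebraMap R ℚ) = C • E := (baseChange_integralModel_eq R _).trans hC
  have hcard : Nat.card k = p := card_residueField_pLocalIntegers p
  have : Finite k := Nat.finite_of_card_ne_zero (by rw [hcard]; exact hpp.ne_zero)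
  let : Fintype k := Fintype.ofFinite k
  have hcard' : Fintype.card k = p := by rw [← Nat.card_eq_fintype_card, hcard]
  have : CharP k p := charP_residueField_pLocalIntegers p
  have : CharP Ω p := charP_of_injective_algebraMap (algebraMap k Ω).injective p
  have hred : (W.map (IsLocalRing.residue R)).IsElliptic :=
    (hasGoodReduction_iff_isElliptic_reduction R).1 hgood
  have : FaithfulSMul R K := FaithfulSMul.trans R ℚ K
  have : IsFractionRing B K := integralClosure.isFractionRing_of_finite_extension ℚ K
  have : Module.Finite R B := IsIntegralClosure.finite R ℚ K B
  have : Finite (B ≃ₐ[R] B) := Finite.of_equiv _ (galRestrict R ℚ K B).toEquiv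
  have : Algebra.IsInvariant R B (B ≃ₐ[R] B) := Algebra.isInvariant_of_isGalois' R ℚ K B
  -- Over K the integral model differs from E by a change of variables defined over ℚ, hence
  -- commuting with the Galois action.
  have hmap : (W.map (algebraMap R B)).map (algebraMap B K) =
      (C.map (algebraMap ℚ K)) • (E.map (algebraMap ℚ K)) := by
    rw [map_variableChange, ← hW, map_map, map_map]
    rfl
  have hell : ((W.map (algebraMap R B)).map (algebraMap B K)).IsElliptic := by
    rw [hmap]; infer_instance
  have hker : RingHom.ker ((algebraMap k Ω).comp (IsLocalRing.residue R)) =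
      IsLocalRing.maximalIdeal R := by
    rw [RingHom.ker_comp_of_injective _ (algebraMap k Ω).injective, IsLocalRing.ker_residue]
  obtain ⟨θ, hθ⟩ := exists_ringHom_comp_algebraMap_eq (B := B) hker
  have hn : IsUnit ((p + 1 : ℕ) : B) := by
    have := (isUnit_natCast_pLocalIntegers p (m := p + 1) (by
      rw [Nat.dvd_add_right (dvd_refl p)]
      exact fun h => hpp.one_lt.ne' (Nat.dvd_one.1 h))).map (algebraMap R B)
    rwa [map_natCast] at this
  have hgenB : ∀ τ : B ≃ₐ[R] B, (∀ a b, (W.map (algebraMap R B)).IsTorsionPair (p + 1) a b →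
      τ a = a ∧ τ b = b) → τ = 1 := by
    intro τ hτ
    obtain ⟨σ, rfl⟩ := (galRestrict R ℚ K B).surjective τ
    rw [hgen σ, map_one]
    intro X Y hXY
    obtain ⟨x, rfl⟩ := (C.map (algebraMap ℚ K)).mapX_surjective X
    obtain ⟨y, rfl⟩ := (C.map (algebraMap ℚ K)).mapY_surjective x Y
    rw [isTorsionPair_mapX_mapY_iff, ← hmap] at hXY
    obtain ⟨h, hP⟩ := isTorsionPair_iff.1 hXY
    -- p + 1 is a unit in B, so every torsion point over K comes from a torsion pair over B, on
    -- which τ acts trivially.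
    obtain ⟨a, b, rfl, rfl⟩ := exists_integral_coordinates hn hP
    rw [isTorsionPair_map_iff (IsIntegralClosure.algebraMap_injective B R K)] at hXY
    obtain ⟨ha, hb⟩ := hτ a b hXY
    have ha' := algebraMap_galRestrict_apply R (K := ℚ) (L := K) σ a
    have hb' := algebraMap_galRestrict_apply R (K := ℚ) (L := K) σ b
    rw [ha] at ha'
    rw [hb] at hb'
    simp only [VariableChange.mapX, VariableChange.mapY, VariableChange.map_u,
      VariableChange.map_r, VariableChange.map_s, VariableChange.map_t, Units.coe_map,
      MonoidHom.coe_coe, map_add, map_mul, map_pow, AlgEquiv.commutes, ← ha', ← hb', and_self]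
  have hfrob : ∃ τ : B ≃ₐ[R] B, ∀ b, θ (τ b) = θ b ^ p := by
    have := exists_map_eq_pow (θ := θ) (by rw [hθ, hker])
    rwa [hcard] at this
  obtain ⟨hsq, hfree⟩ := pow_sq_eq_self_and_eq_one_of_map_eq (K := K) W hθ hpp hp hcard' htr hn
    hgenB hfrob
  obtain ⟨i, hi⟩ : ∃ i : NumberField.RingOfIntegers K →+* B, ∀ x, (i x : K) = x := by
    have hint : ∀ x : NumberField.RingOfIntegers K, IsIntegral R (x : K) := fun x =>
      (NumberField.RingOfIntegers.isIntegral_coe x).tower_top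
    exact ⟨(algebraMap (NumberField.RingOfIntegers K) K).codRestrict B.toSubring hint,
      fun _ => rfl⟩
  have key := card_algEquiv_le hpp.one_lt hcard' hsq hfree (α := i α) fun f g h =>
    ringHom_eq_of_not_dvd_index hα hi h
  rwa [← Nat.card_congr (galRestrict R ℚ K B).toEquiv, IsGalois.card_aut_eq_finrank] at key

/-! ### The division field as a normal extension generated by torsion coordinates. -/

section DivisionField

variable (E : WeierstrassCurve ℚ) [E.IsElliptic] (n : ℕ)

open Classical in
lemma divisionField_eq_adjoin : divisionField E n = IntermediateField.adjoin ℚ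
    {z | ∃ x y, (E.map (algebraMap ℚ (AlgebraicClosure ℚ))).IsTorsionPair n x y ∧
      (z = x ∨ z = y)} := by
  rw [divisionField]
  congr 1
  ext z
  constructor
  · rintro ⟨x, y, h, hP, hz⟩
    exact ⟨x, y, isTorsionPair_iff.2 ⟨h, hP⟩, hz⟩
  · rintro ⟨x, y, hxy, hz⟩
    obtain ⟨h, hP⟩ := isTorsionPair_iff.1 hxy
    exact ⟨x, y, h, hP, hz⟩

/-- Two ℚ-algebra structures on this field occur; they agree because a ring has at most one. -/
lemma normal_algebraicClosure_rat : Normal ℚ (AlgebraicClosure ℚ) := by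
  have h : @Normal ℚ (AlgebraicClosure ℚ) _ _ (AlgebraicClosure.instAlgebra ℚ) :=
    @IsAlgClosure.normal ℚ (AlgebraicClosure ℚ) _ _ (AlgebraicClosure.instAlgebra ℚ) inferInstance
  convert h
  exact Subsingleton.elim _ _

instance normal_divisionField : Normal ℚ (divisionField E n) := by
  suffices h : @Normal ℚ (divisionField E n) _ _ (divisionField E n).algebra' by
    convert h
    exact Subsingleton.elim _ _
  have := normal_algebraicClosure_rat
  refine IntermediateField.normal_iff_forall_map_le'.2 fun σ => ?_
  rw [divisionField_eq_adjoin, IntermediateField.adjoin_map]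
  refine IntermediateField.adjoin.mono _ _ _ ?_
  rintro _ ⟨z, ⟨x, y, hxy, hz⟩, rfl⟩
  have h := hxy.map (σ : AlgebraicClosure ℚ →+* AlgebraicClosure ℚ)
  rw [map_map, show (σ : AlgebraicClosure ℚ →+* AlgebraicClosure ℚ).comp (algebraMap ℚ _) =
    algebraMap ℚ _ from σ.toAlgHom.comp_algebraMap] at h
  exact ⟨σ x, σ y, h, hz.imp (congrArg σ) (congrArg σ)⟩

lemma eq_one_of_forall_isTorsionPair (σ : Gal(divisionField E n/ℚ))
    (hσ : ∀ x y, (E.map (algebraMap ℚ (divisionField E n))).IsTorsionPair n x y →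
      σ x = x ∧ σ y = y) : σ = 1 := by
  have key : ∀ z (hz : z ∈ divisionField E n), σ ⟨z, hz⟩ = ⟨z, hz⟩ := by
    intro z hz
    have hz' := hz
    rw [divisionField_eq_adjoin] at hz'
    revert hz
    induction hz' using IntermediateField.adjoin_induction with
    | mem z hz =>
      intro hz'
      obtain ⟨x, y, hxy, hzxy⟩ := hz
      have hx : x ∈ divisionField E n := by
        rw [divisionField_eq_adjoin]
        exact IntermediateField.subset_adjoin _ _ ⟨x, y, hxy, Or.inl rfl⟩
      have hy : y ∈ divisionField E n := by
        rw [divisionField_eq_adjoin]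
        exact IntermediateField.subset_adjoin _ _ ⟨x, y, hxy, Or.inr rfl⟩
      have h := hσ ⟨x, hx⟩ ⟨y, hy⟩ (by
        rw [← isTorsionPair_map_iff
          (algebraMap (divisionField E n) (AlgebraicClosure ℚ)).injective, map_map]
        exact hxy)
      rcases hzxy with rfl | rfl
      exacts [h.1, h.2]
    | algebraMap x => exact fun hz => σ.commutes x
    | add x y hx hy ihx ihy =>
      rw [← divisionField_eq_adjoin] at hx hy
      intro hz
      have := map_add σ ⟨x, hx⟩ ⟨y, hy⟩
      rwa [ihx hx, ihy hy] at this
    | mul x y hx hy ihx ihy =>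
      rw [← divisionField_eq_adjoin] at hx hy
      intro hz
      have := map_mul σ ⟨x, hx⟩ ⟨y, hy⟩
      rwa [ihx hx, ihy hy] at this
    | inv x hx ihx =>
      rw [← divisionField_eq_adjoin] at hx
      intro hz
      have := map_inv₀ σ ⟨x, hx⟩
      rwa [ihx hx] at this
  exact AlgEquiv.ext fun z => key z z.2

end DivisionField

theorem theorem4p7 (E : WeierstrassCurve ℚ) [E.IsElliptic] (p : ℕ) [Fact p.Prime] (hp : 3 < p)
    (hE : HasGoodSupersingularReduction E p)
    (hdeg : p ^ 2 - p < Module.finrank ℚ (divisionField E (p + 1))) :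
    ¬ IsMonogenicField (divisionField E (p + 1)) ∧
      IsEssentialDiscriminantDivisor p (divisionField E (p + 1)) := by
  -- `finrank` is 0 in infinite dimension, so the degree hypothesis gives finiteness.
  have : FiniteDimensional ℚ (divisionField E (p + 1)) :=
    FiniteDimensional.of_finrank_pos (by omega)
  have : IsGalois ℚ (divisionField E (p + 1)) := ⟨⟩
  have hdvd : ∀ α : NumberField.RingOfIntegers (divisionField E (p + 1)),
      p ∣ (Subalgebra.toSubmodule (Algebra.adjoin ℤ {α})).toAddSubgroup.index := by
    intro α
    by_contra hα
    exact hdeg.not_ge (finrank_le_of_hasGoodSupersingularReduction hp hE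
      (eq_one_of_forall_isTorsionPair E (p + 1)) hα)
  refine ⟨?_, fun α _ => hdvd α⟩
  rintro ⟨B⟩
  -- The generator of a power basis has index 1, which p does not divide.
  have h := hdvd B.gen
  rw [B.adjoin_gen_eq_top, Algebra.top_toSubmodule, Submodule.top_toAddSubgroup,
    AddSubgroup.index_top, Nat.dvd_one] at h
  exact (Fact.out : p.Prime).one_lt.ne' h
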